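/- **Setting.** Let $E$ be a finite-dimensional real vector space. A polyhedron is a set defined by finitely many inequalities $cx\le b$; a face of a polyhedron $P$ is a set $\{x\in P: cx=b\}$, where $cx\le b$ holds on all of $P$; a facet is a nonempty face of codimension one. A polyhedron $P\subseteq E$ is simple if it is full-dimensional and every nonempty face of codimension $k$ lies in exactly $k$ facets. Let $\{F_s: s\in\mathcal S\}$ be the facets of $P$ and put $F_S=P\cap\bigcap_{s\in S}F_s$ for $S\subseteq\mathcal S$. The dual simplicial complex $\Delta(P)$ consists of all $S\subseteq \mathcal S$ with $F_S\neq\emptyset$. A *building set* of a meet-semilattice $L$ with least element $\hat 0$ is a set $\mathcal B\subseteq L\setminus\{\hat 0\}$ such that for every $x\ne\hat 0$, if $x_1,\dots,x_k$ are the maximal elements of $\{y\in\mathcal B: y\le x\}$, there is an isomorphism of posets $\prod_j[\hat 0,x_j]\to[\hat 0,x]$ that sends $(\hat 0,\dots,x_j,\dots,\hat 0)$ to $x_j$ for each $j$. A subset $N\subseteq\mathcal B$ is *nested* if for every set of at least two pairwise incomparable elements of $N$ the join exists and is not in $\mathcal B$; the nested sets form the *nested complex* of $\mathcal B$. A *$P$-building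 set* is a building set of the poset $\Delta(P)$ of faces ordered by inclusion (with $\hat 0=\emptyset$). A *$P$-nestohedron* of $\mathcal B$ is a simple polyhedron whose dual simplicial complex is isomorphic to the nested complex of $\mathcal B$. An inequality $ax\le b$ *truncates* a polyhedron $Q$ at its face $F$ if $ax>b$ on $F$; the hyperplane $ax=b$ meets every face $F'$ of $Q$ with $F'\cap F\neq\emptyset$ and $F'\not\subseteq F$; and $ax<b$ on every face $F'$ of $Q$ with $F'\cap F=\emptyset$. The resulting truncation is $Q\cap\{x: ax\le b\}$. **Theorem.** Let $P$ be a simple polyhedron and $\mathcal B$ a $P$-building set. Then the elements of $\mathcal B$ can be listed, each exactly once, as $S_1,\dots,S_k$ with $|S_i|\ge|S_{i+1}|$ for all $i<k$. For every such listing, it is possible to truncate successively the faces $F_{S_1},\dots,F_{S_k}$: that is, there are $P_0=P,P_1,\dots,P_k$ such that each $P_i$ is a truncation of $P_{i-1}$ at its face $F_{S_i}\cap P_{i-1}$. Moreover, for every such listing and every such sequence of truncations (whatever truncating inequalities are chosen), $P_k$ is a $P$-nestohedron of $\mathcal B$; that is, $P_k$ is a simple polyhedron whose dual simplicial complex is isomorphic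 to the nested complex of $\mathcal B$. -/

import Mathlib

/-! ### Building sets and nested sets of meet-semilattices -/

section Semilattice

variable {L : Type*} [SemilatticeInf L] [OrderBot L]

/-- The set `max B_{≤ x}` of maximal elements of `{y ∈ B | y ≤ x}`. -/
def maxBelow (B : Set L) (x : L) : Set L :=
  {y | Maximal (fun z => z ∈ B ∧ z ≤ x) y}

open Classical in
/-- `B ⊆ L \ {⊥}` is a building set of the semilattice `L`: for every `x ≠ ⊥` with
`max B_{≤ x} = {x₁, …, xₖ}` there is an isomorphism of posets `∏ⱼ [⊥, xⱼ] ≃ [⊥, x]` taking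
`(⊥, …, xⱼ, …, ⊥)` to `xⱼ` for each `j`. -/
def IsBuildingSet (B : Set L) : Prop :=
  ⊥ ∉ B ∧ ∀ x : L, x ≠ ⊥ →
    ∃ φ : ((j : maxBelow B x) → Set.Iic (j : L)) ≃o Set.Iic x,
      ∀ j : maxBelow B x,
        ((φ (Function.update (fun i => (⊥ : Set.Iic (i : L))) j ⊤) : Set.Iic x) : L) = j

/-- `N ⊆ B` is nested: the join of any set of at least two pairwise incomparable elements of `N`
exists and is not in `B`. -/
def IsNested (B N : Set L) : Prop :=
  N ⊆ B ∧ ∀ N' ⊆ N, IsAntichain (· ≤ ·) N' → N'.Nontrivial → ∃ z, IsLUB N' z ∧ z ∉ B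

/-- The nested complex of `B`: the simplicial complex on the base set `B` whose (nonempty) faces
are the (nonempty, finite) nested sets. -/
def nestedComplex (B : Set L) : AbstractSimplicialComplex B where
  faces := {N | N.Nonempty ∧ IsNested B (Subtype.val '' (N : Set B))}
  isRelLowerSet_faces := by
    rintro N ⟨hN, hB, h⟩
    refine ⟨hN, fun M hM hne => ⟨hne, ?_, ?_⟩⟩
    · rintro _ ⟨y, -, rfl⟩
      exact y.2
    · exact fun N' hN' => h N' (hN'.trans (Set.image_mono (by exact_mod_cast hM)))
  singleton_mem := by
    intro v
    refine ⟨Finset.singleton_nonempty v, ?_, ?_⟩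
    · rintro _ ⟨y, -, rfl⟩
      exact y.2
    · intro N' hN' _ hnt
      rw [Finset.coe_singleton, Set.image_singleton] at hN'
      exact absurd (Set.subsingleton_singleton.anti hN') (Set.not_subsingleton_iff.2 hnt)

end Semilattice

/-! ### Simplicial complexes -/

/-- The face poset of a simplicial complex, with the empty face (which is not recorded in
`K.faces`) as least element. -/
def FacePoset {ι : Type*} (K : AbstractSimplicialComplex ι) : Type _ :=
  {S : Finset ι // S = ∅ ∨ S ∈ K.faces}

namespace FacePoset

variable {ι : Type*} {K : AbstractSimplicialComplex ι}

instance : PartialOrder (FacePoset K) :=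
  inferInstanceAs (PartialOrder {S : Finset ι // S = ∅ ∨ S ∈ K.faces})

instance : OrderBot (FacePoset K) where
  bot := ⟨∅, Or.inl rfl⟩
  bot_le S := Finset.empty_subset S.1

open Classical in
noncomputable instance : SemilatticeInf (FacePoset K) where
  inf S T := ⟨S.1 ∩ T.1, by
    rcases (S.1 ∩ T.1).eq_empty_or_nonempty with h | h
    · exact Or.inl h
    · refine Or.inr ?_
      rcases S.2 with h' | h'
      · rw [h', Finset.empty_inter] at h
        exact absurd h Finset.not_nonempty_empty
      · exact (K.isRelLowerSet_faces h').2 Finset.inter_subset_left h⟩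
  inf_le_left S T := (Finset.inter_subset_left : S.1 ∩ T.1 ⊆ S.1)
  inf_le_right S T := (Finset.inter_subset_right : S.1 ∩ T.1 ⊆ T.1)
  le_inf S T U (h₁ : S.1 ⊆ T.1) (h₂ : S.1 ⊆ U.1) :=
    (Finset.subset_inter h₁ h₂ : S.1 ⊆ T.1 ∩ U.1)

end FacePoset

/-- Isomorphism of simplicial complexes: a bijection of base sets under which faces correspond to
faces in both directions. -/
def SimplicialIsomorphic {ι κ : Type*} (K : AbstractSimplicialComplex ι)
    (K' : AbstractSimplicialComplex κ) : Prop :=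
  ∃ e : ι ≃ κ, ∀ S : Finset ι, S ∈ K.faces ↔ S.map e.toEmbedding ∈ K'.faces

/-! ### Polyhedra -/

section Polyhedra

variable {E : Type*} [AddCommGroup E] [Module ℝ E]

/-- A polyhedron is the solution set of finitely many weak linear inequalities `c x ≤ b`. -/
def IsPolyhedron (P : Set E) : Prop :=
  ∃ H : Finset (Module.Dual ℝ E × ℝ), P = {x | ∀ h ∈ H, h.1 x ≤ h.2}

/-- `F` is a face of `P`: the set of points of `P` at which some valid inequality `c x ≤ b` is
an equality. Both `∅` and `P` are faces. -/
def IsFace (P F : Set E) : Prop :=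
  ∃ (c : Module.Dual ℝ E) (b : ℝ), (∀ x ∈ P, c x ≤ b) ∧ F = {x ∈ P | c x = b}

/-- The dimension of the affine hull of a (nonempty) set. -/
noncomputable def affineDim (F : Set E) : ℕ :=
  Module.finrank ℝ (affineSpan ℝ F).direction

/-- A facet: a nonempty face of codimension one in the ambient space. -/
def IsFacet (P F : Set E) : Prop :=
  IsFace P F ∧ F.Nonempty ∧ affineDim F + 1 = Module.finrank ℝ E

/-- A simple polyhedron: a full-dimensional polyhedron each of whose nonempty faces of
codimension `k` is contained in exactly `k` facets. -/
def IsSimplePolyhedron (P : Set E) : Prop :=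
  IsPolyhedron P ∧ affineSpan ℝ P = ⊤ ∧
    ∀ F, IsFace P F → F.Nonempty →
      (affineDim F : ℕ∞) + {G | IsFacet P G ∧ F ⊆ G}.encard = (Module.finrank ℝ E : ℕ∞)

/-- The set of facets of `P`, as a type. -/
def Facet (P : Set E) : Type _ := {F : Set E // IsFacet P F}

/-- The face `F_S` of `P`: the intersection of the facets in `S` (`P` itself if `S = ∅`). -/
def faceOf (P : Set E) (S : Finset (Facet P)) : Set E :=
  {x ∈ P | ∀ s ∈ S, x ∈ s.1}

/-- The dual simplicial complex of `P`: the (nonempty) sets `S` of facets with `F_S ≠ ∅`. -/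
def dualComplex (P : Set E) : AbstractSimplicialComplex (Facet P) where
  faces := {S | S.Nonempty ∧ (faceOf P S).Nonempty}
  isRelLowerSet_faces := by
    rintro S ⟨hS, x, hx, hxS⟩
    exact ⟨hS, fun T hT hne => ⟨hne, x, hx, fun s hs => hxS s (hT hs)⟩⟩
  singleton_mem := by
    intro s
    refine ⟨Finset.singleton_nonempty s, ?_⟩
    obtain ⟨⟨c, b, -, h⟩, ⟨x, hx⟩, -⟩ := s.2
    refine ⟨x, (h ▸ hx : x ∈ {x ∈ P | c x = b}).1, fun t ht => ?_⟩
    rw [Finset.mem_singleton] at ht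
    exact ht ▸ hx

/-- The inequality `a x ≤ b` truncates the polyhedron `Q` at its face `F`. -/
structure Truncates (a : Module.Dual ℝ E) (b : ℝ) (Q F : Set E) : Prop where
  isFace : IsFace Q F
  face_subset : F ⊆ {x | b < a x}
  meets : ∀ F', IsFace Q F' → (F' ∩ F).Nonempty → ¬ F' ⊆ F → ({x | a x = b} ∩ F').Nonempty
  avoids : ∀ F', IsFace Q F' → F' ∩ F = ∅ → F' ⊆ {x | a x < b}

/-- `RepeatedTruncation Q [F₁, …, Fₖ] R`: the set `R` arises from `Q` by truncating the faces
`F₁, …, Fₖ` in this order. When `Fᵢ` is due, what is truncated is the part of `Fᵢ` that lies in the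
current polyhedron, that is, the intersection of the facets that remain of those defining `Fᵢ`. -/
inductive RepeatedTruncation : Set E → List (Set E) → Set E → Prop
  | nil (Q : Set E) : RepeatedTruncation Q [] Q
  | cons {Q F R : Set E} {l : List (Set E)} (a : Module.Dual ℝ E) (b : ℝ) :
      Truncates a b Q (F ∩ Q) → RepeatedTruncation (Q ∩ {x | a x ≤ b}) l R →
      RepeatedTruncation Q (F :: l) R

/-- `l` lists the elements of `B`, each exactly once, in order of weakly decreasing size. -/
def IsDecreasingListing {P : Set E} (B : Set (FacePoset (dualComplex P)))
    (l : List (FacePoset (dualComplex P))) : Prop :=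
  l.Nodup ∧ (∀ S, S ∈ l ↔ S ∈ B) ∧ l.Pairwise (fun S T => T.1.card ≤ S.1.card)

/-- `Q` is a `P`-nestohedron of `B`: a simple polyhedron whose dual simplicial complex is
isomorphic to the nested complex of `B`. -/
def IsNestohedron {P : Set E} (B : Set (FacePoset (dualComplex P))) (Q : Set E) : Prop :=
  IsSimplePolyhedron Q ∧ SimplicialIsomorphic (dualComplex Q) (nestedComplex B)

end Polyhedra

/-! Every stage is described by a regular system: finitely many inequalities, solvable, with
linearly independent active functionals at each solution. In such a system the codimension of a face
is the number of constraints active at a generic point. Hence the polyhedron is simple once each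
constraint is active somewhere, and its dual complex records which index sets can be active
together. A simple polyhedron has such a system, indexed by its facets
(`IsSimplePolyhedron.exists_isRegularSystem`).

Truncating the face of an index set `σ` adds one inequality, or overwrites the old one if `σ` is a
single index, and keeps the system regular (`IsRegularSystem.insert_update`). The conditions on a
truncating inequality determine which faces survive and which meet the new facet: the dual complex
undergoes a stellar subdivision at `σ`, whatever inequality is chosen.

Nested sets change by the same rule when a face `S` is adjoined to a set of faces that contains all
vertices, provided that its only members below `S` are vertices or `S` itself and that unions of
intersecting members, when faces, remain members after adjoining (`isNested_insert_iff_of_notMem`,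
`isNested_insert_insert_iff`). Decreasing size guarantees the first proviso. Both it and the union
property of building sets (`IsBuildingSet.isUnionClosed`) yield the second.

The induction starts from the vertices, whose nested sets are the sets of vertices of a common face.
It ends at `B`, because a building set contains all vertices. -/

/-! ### Systems of linear inequalities -/

section Systems

open Filter Topology

variable {E : Type*} [AddCommGroup E] [Module ℝ E] {ι : Type*}
  {V : Set ι} {a : ι → Module.Dual ℝ E} {b : ι → ℝ}

/-- The solution set of the inequalities `a i x ≤ b i`, `i ∈ V`. -/
def solutionSet (V : Set ι) (a : ι → Module.Dual ℝ E) (b : ι → ℝ) : Set E :=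
  {x | ∀ i ∈ V, a i x ≤ b i}

/-- The indices in `V` of the constraints that are equalities at `x`. -/
def activeSet (V : Set ι) (a : ι → Module.Dual ℝ E) (b : ι → ℝ) (x : E) : Set ι :=
  {i ∈ V | a i x = b i}

/-- The solutions at which all constraints with index in `N` are equalities. -/
def tightFace (V : Set ι) (a : ι → Module.Dual ℝ E) (b : ι → ℝ) (N : Set ι) : Set E :=
  {x ∈ solutionSet V a b | ∀ i ∈ N, a i x = b i}

theorem activeSet_subset (x : E) : activeSet V a b x ⊆ V := fun _ h => h.1

theorem mem_tightFace_activeSet {x : E} (hx : x ∈ solutionSet V a b) :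
    x ∈ tightFace V a b (activeSet V a b x) := ⟨hx, fun _ h => h.2⟩

theorem mem_tightFace_iff {N : Set ι} (hN : N ⊆ V) {x : E} :
    x ∈ tightFace V a b N ↔ x ∈ solutionSet V a b ∧ N ⊆ activeSet V a b x :=
  and_congr_right fun _ => ⟨fun h _ hi => ⟨hN hi, h _ hi⟩, fun h _ hi => (h hi).2⟩

theorem tightFace_anti {N M : Set ι} (h : N ⊆ M) : tightFace V a b M ⊆ tightFace V a b N :=
  fun _ hx => ⟨hx.1, fun i hi => hx.2 i (h hi)⟩

theorem tightFace_union (N M : Set ι) :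
    tightFace V a b (N ∪ M) = tightFace V a b N ∩ tightFace V a b M := by
  ext x
  simp only [tightFace, Set.mem_ofPred_eq, Set.mem_inter_iff, Set.mem_union]
  grind

theorem tightFace_empty : tightFace V a b ∅ = solutionSet V a b := by
  ext x
  simp [tightFace]

/-- An average of two numbers, both at most `b i`, equals `b i` only if both do. Active sets on a
convex set of solutions are therefore closed under intersection. -/
theorem activeSet_midpoint {x y : E} (hx : x ∈ solutionSet V a b) (hy : y ∈ solutionSet V a b) :
    activeSet V a b ((1 / 2 : ℝ) • x + (1 / 2 : ℝ) • y) =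
      activeSet V a b x ∩ activeSet V a b y := by
  ext i
  simp only [activeSet, Set.mem_ofPred_eq, Set.mem_inter_iff, map_add, map_smul, smul_eq_mul]
  constructor
  · rintro ⟨hi, h⟩
    have h₁ := hx i hi
    have h₂ := hy i hi
    exact ⟨⟨hi, by linarith⟩, hi, by linarith⟩
  · rintro ⟨⟨hi, h₁⟩, -, h₂⟩
    exact ⟨hi, by rw [h₁, h₂]; ring⟩

theorem convex_solutionSet : Convex ℝ (solutionSet V a b) := by
  intro x hx y hy s t hs ht hst i hi
  have h₁ := mul_le_mul_of_nonneg_left (hx i hi) hs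
  have h₂ := mul_le_mul_of_nonneg_left (hy i hi) ht
  simp only [map_add, map_smul, smul_eq_mul]
  calc s * a i x + t * a i y ≤ s * b i + t * b i := add_le_add h₁ h₂
    _ = b i := by rw [← add_mul, hst, one_mul]

/-- A nonempty convex set of solutions has a point at which as few constraints as possible are
active. -/
theorem exists_activeSet_minimal (hV : V.Finite) {F : Set E} (hF : F ⊆ solutionSet V a b)
    (hc : Convex ℝ F) (hne : F.Nonempty) :
    ∃ x ∈ F, ∀ y ∈ F, activeSet V a b x ⊆ activeSet V a b y := by
  obtain ⟨x, hx, hmin⟩ := exists_minimalFor_of_wellFoundedLT (fun x => x ∈ F)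
    (fun x => (activeSet V a b x).ncard) hne
  refine ⟨x, hx, fun y hy => ?_⟩
  have hm := activeSet_midpoint (hF hx) (hF hy)
  have hz : (1 / 2 : ℝ) • x + (1 / 2 : ℝ) • y ∈ F :=
    hc hx hy (by norm_num) (by norm_num) (by norm_num)
  have hle : (activeSet V a b ((1 / 2 : ℝ) • x + (1 / 2 : ℝ) • y)).ncard ≤
      (activeSet V a b x).ncard := by
    rw [hm]
    exact Set.ncard_le_ncard Set.inter_subset_left (hV.subset (activeSet_subset x))
  have := hmin hz hle
  simp only [hm] at this
  have heq := Set.eq_of_subset_of_ncard_le Set.inter_subset_left this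
    (hV.subset (activeSet_subset x))
  exact Set.inter_eq_left.1 heq

theorem eventually_inactive (hV : V.Finite) (x v : E) :
    ∀ᶠ t in 𝓝 (0 : ℝ), ∀ i ∈ V, a i x < b i → a i (x + t • v) < b i := by
  refine hV.eventually_all.2 fun i _ => ?_
  by_cases h : a i x < b i
  · have hc : Continuous fun t : ℝ => a i x + t * a i v := by fun_prop
    have : Tendsto (fun t : ℝ => a i x + t * a i v) (𝓝 0) (𝓝 (a i x)) := by
      simpa using hc.tendsto 0
    filter_upwards [this.eventually_lt_const h] with t ht _
    simpa using ht
  · exact Eventually.of_forall fun t h' => absurd h' h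

/-- One may move a little from a solution in any direction that no active constraint forbids. -/
theorem eventually_mem_solutionSet (hV : V.Finite) {x v : E} (hx : x ∈ solutionSet V a b)
    (hv : ∀ i ∈ activeSet V a b x, a i v ≤ 0) :
    ∀ᶠ t in 𝓝[>] (0 : ℝ), x + t • v ∈ solutionSet V a b := by
  filter_upwards [(eventually_inactive hV x v).filter_mono nhdsWithin_le_nhds,
    self_mem_nhdsWithin] with t ht ht0 i hi
  rcases (hx i hi).lt_or_eq with h | h
  · exact (ht i hi h).le
  · have := mul_nonpos_of_nonneg_of_nonpos (le_of_lt ht0 : (0 : ℝ) ≤ t) (hv i ⟨hi, h⟩)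
    simp only [map_add, map_smul, smul_eq_mul]
    linarith

theorem IsFace.convex {P F : Set E} (hP : Convex ℝ P) (hF : IsFace P F) : Convex ℝ F := by
  obtain ⟨c, d, -, rfl⟩ := hF
  intro x hx y hy s t hs ht hst
  refine ⟨hP hx.1 hy.1 hs ht hst, ?_⟩
  simp only [map_add, map_smul, smul_eq_mul, hx.2, hy.2]
  rw [← add_mul, hst, one_mul]

theorem IsFace.subset {P F : Set E} (hF : IsFace P F) : F ⊆ P := by
  obtain ⟨c, d, -, rfl⟩ := hF
  exact fun x hx => hx.1

/-- A face that contains `x` contains all points at which the constraints active at `x` are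
active. -/
theorem IsFace.tightFace_subset (hV : V.Finite) {F : Set E} (hF : IsFace (solutionSet V a b) F)
    {x : E} (hx : x ∈ F) : tightFace V a b (activeSet V a b x) ⊆ F := by
  obtain ⟨c, d, hcd, rfl⟩ := hF
  intro y hy
  refine ⟨hy.1, le_antisymm (hcd y hy.1) ?_⟩
  -- The segment from `y` to `x` extends slightly beyond `x` inside the polyhedron; validity of `c`
  -- there forces `c y ≥ d`.
  have hv : ∀ i ∈ activeSet V a b x, a i (x - y) ≤ 0 := fun i hi => by
    rw [map_sub, hi.2, hy.2 i hi, sub_self]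
  obtain ⟨t, ht, ht0⟩ :=
    ((eventually_mem_solutionSet hV hx.1 hv).and self_mem_nhdsWithin).exists
  have h := hcd _ ht
  simp only [map_add, map_smul, map_sub, smul_eq_mul, hx.2] at h
  have : t * (d - c y) ≤ 0 := by linarith
  have := nonpos_of_mul_nonpos_right this ht0
  linarith

/-- A point with fewest active constraints plays the role of a relative interior point, and the
constraints active there cut out the face. -/
theorem IsFace.exists_eq_tightFace (hV : V.Finite) {F : Set E}
    (hF : IsFace (solutionSet V a b) F) (hne : F.Nonempty) :
    ∃ x ∈ F, F = tightFace V a b (activeSet V a b x) := by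
  obtain ⟨x, hx, hmin⟩ :=
    exists_activeSet_minimal hV hF.subset (hF.convex convex_solutionSet) hne
  refine ⟨x, hx, Set.Subset.antisymm (fun y hy => ?_) (hF.tightFace_subset hV hx)⟩
  exact (mem_tightFace_iff (activeSet_subset x)).2 ⟨hF.subset hy, hmin y hy⟩

theorem finite_setOf_isFace (hV : V.Finite) : {F | IsFace (solutionSet V a b) F}.Finite := by
  refine ((hV.powerset.image (tightFace V a b)).insert ∅).subset fun F hF => ?_
  rcases F.eq_empty_or_nonempty with h | h
  · exact Or.inl h
  · obtain ⟨x, -, hx⟩ := IsFace.exists_eq_tightFace hV hF h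
    exact Or.inr ⟨_, activeSet_subset x, hx.symm⟩

/-- The sum of the inequalities in `N` is valid, and it is tight exactly where every summand is. -/
theorem isFace_tightFace (hV : V.Finite) {N : Set ι} (hN : N ⊆ V) :
    IsFace (solutionSet V a b) (tightFace V a b N) := by
  classical
  have hf := hV.subset hN
  have key : ∀ x ∈ solutionSet V a b, ∀ i ∈ hf.toFinset, a i x ≤ b i :=
    fun x hx i hi => hx i (hN (hf.mem_toFinset.1 hi))
  refine ⟨∑ i ∈ hf.toFinset, a i, ∑ i ∈ hf.toFinset, b i, fun x hx => ?_, ?_⟩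
  · rw [LinearMap.sum_apply]
    exact Finset.sum_le_sum (key x hx)
  · ext x
    refine and_congr_right fun hx => ?_
    rw [LinearMap.sum_apply, Finset.sum_eq_sum_iff_of_le (key x hx)]
    simp

/-! ### Linear functionals on polyhedra -/

/-- From a point of a face on which `c` is bounded one can move to a point where `c` is at least
as large and constant along the smallest face. -/
theorem exists_vertexlike (hV : V.Finite) {N : Set ι} (hN : N ⊆ V) {c : Module.Dual ℝ E} {d : ℝ}
    (hc : ∀ x ∈ tightFace V a b N, c x < d) {x : E} (hx : x ∈ tightFace V a b N) :
    ∃ y ∈ tightFace V a b N, c x ≤ c y ∧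
      ∀ v, (∀ i ∈ activeSet V a b y, a i v = 0) → c v = 0 := by
  induction h : (V \ activeSet V a b x).ncard using Nat.strong_induction_on generalizing x with
  | _ n ih =>
  by_cases hg : ∀ v, (∀ i ∈ activeSet V a b x, a i v = 0) → c v = 0
  · exact ⟨x, hx, le_rfl, hg⟩
  obtain ⟨v, hv, hcv⟩ : ∃ v, (∀ i ∈ activeSet V a b x, a i v = 0) ∧ 0 < c v := by
    push Not at hg
    obtain ⟨v, hv, hcv⟩ := hg
    rcases hcv.lt_or_gt with h | h
    · exact ⟨-v, fun i hi => by rw [map_neg, hv i hi, neg_zero], by rw [map_neg]; linarith⟩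
    · exact ⟨v, hv, h⟩
  have hNact : N ⊆ activeSet V a b x := ((mem_tightFace_iff hN).1 hx).2
  have htight : ∀ t : ℝ, ∀ i ∈ activeSet V a b x, a i (x + t • v) = b i := fun t i hi => by
    rw [map_add, map_smul, hv i hi, hi.2, smul_zero, add_zero]
  -- If no constraint blocked the ray along `v`, the functional `c` would reach the value `d` on it.
  have hex : {i ∈ V | 0 < a i v}.Nonempty := by
    by_contra hempty
    have hle : ∀ i ∈ V, a i v ≤ 0 := fun i hi => by
      by_contra hcon
      exact hempty ⟨i, hi, not_le.1 hcon⟩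
    have hmem : x + ((d - c x) / c v) • v ∈ tightFace V a b N := by
      refine ⟨fun i hi => ?_, fun i hi => htight _ i (hNact hi)⟩
      have h0 : 0 ≤ (d - c x) / c v := div_nonneg (by linarith [hc x hx]) hcv.le
      have := mul_nonpos_of_nonneg_of_nonpos h0 (hle i hi)
      have := hx.1 i hi
      simp only [map_add, map_smul, smul_eq_mul]
      linarith
    have := hc _ hmem
    simp only [map_add, map_smul, smul_eq_mul] at this
    rw [div_mul_cancel₀ _ hcv.ne'] at this
    linarith
  -- Ratio test: stop where the first constraint becomes tight. Active constraints stay active and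
  -- `j` joins them, so the number of inactive ones drops.
  obtain ⟨j, ⟨hjV, hj⟩, hmin⟩ := Set.exists_min_image {i ∈ V | 0 < a i v}
    (fun i => (b i - a i x) / a i v) (hV.subset fun i hi => hi.1) hex
  set t := (b j - a j x) / a j v with ht
  have ht0 : 0 ≤ t := div_nonneg (by linarith [hx.1 j hjV]) hj.le
  have hmem : x + t • v ∈ tightFace V a b N := by
    refine ⟨fun i hi => ?_, fun i hi => htight _ i (hNact hi)⟩
    simp only [map_add, map_smul, smul_eq_mul]
    rcases lt_or_ge 0 (a i v) with hi0 | hi0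
    · have := (le_div_iff₀ hi0).1 (hmin i ⟨hi, hi0⟩)
      linarith
    · have := mul_nonpos_of_nonneg_of_nonpos ht0 hi0
      linarith [hx.1 i hi]
  have hjact : a j (x + t • v) = b j := by
    simp only [map_add, map_smul, smul_eq_mul]
    rw [ht, div_mul_cancel₀ _ hj.ne']
    ring
  have hjx : j ∉ activeSet V a b x := fun hcon => by
    rw [hv j hcon] at hj
    exact lt_irrefl _ hj
  have hlt : (V \ activeSet V a b (x + t • v)).ncard < n := by
    rw [← h]
    refine Set.ncard_lt_ncard (Set.ssubset_iff_exists.2 ⟨?_, j, ⟨hjV, hjx⟩, fun h => ?_⟩)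
      (hV.subset Set.sdiff_subset)
    · exact Set.sdiff_subset_sdiff_right fun i hi => ⟨hi.1, htight t i hi⟩
    · exact h.2 ⟨hjV, hjact⟩
  obtain ⟨y, hy, hle, hgood⟩ := ih _ hlt hmem rfl
  refine ⟨y, hy, le_trans ?_ hle, hgood⟩
  have := mul_nonneg ht0 hcv.le
  simp only [map_add, map_smul, smul_eq_mul]
  linarith

/-- A linear functional that is less than `d` on a face is bounded away from `d` there. -/
theorem eventually_lt_sub_of_lt (hV : V.Finite) {N : Set ι} (hN : N ⊆ V) {c : Module.Dual ℝ E}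
    {d : ℝ} (hc : ∀ x ∈ tightFace V a b N, c x < d) :
    ∀ᶠ ε in 𝓝[>] (0 : ℝ), ∀ x ∈ tightFace V a b N, c x < d - ε := by
  -- At the points supplied by `exists_vertexlike`, the value of `c` depends only on the active set
  -- `A`. Only finitely many values have to be kept away from `d`, even if the face is unbounded.
  have key : ∀ᶠ ε in 𝓝[>] (0 : ℝ), ∀ A ∈ 𝒫 V, ∀ y ∈ tightFace V a b N,
      activeSet V a b y = A → (∀ v, (∀ i ∈ A, a i v = 0) → c v = 0) → c y < d - ε := by
    refine hV.powerset.eventually_all.2 fun A _ => ?_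
    by_cases h : ∃ y ∈ tightFace V a b N, activeSet V a b y = A
    · obtain ⟨y, hy, rfl⟩ := h
      have h0 : 0 < d - c y := by linarith [hc y hy]
      filter_upwards [(eventually_lt_nhds h0).filter_mono nhdsWithin_le_nhds]
        with ε hε z hz hzy hgood
      have : c (z - y) = 0 := hgood _ fun i hi => by
        rw [map_sub, hi.2, (hzy.symm ▸ hi : i ∈ activeSet V a b z).2, sub_self]
      rw [map_sub] at this
      linarith
    · exact Eventually.of_forall fun ε y hy hyA => absurd ⟨y, hy, hyA⟩ h
  filter_upwards [key] with ε hε x hx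
  obtain ⟨y, hy, hle, hgood⟩ := exists_vertexlike hV hN hc hx
  exact hle.trans_lt (hε _ (activeSet_subset y) y hy rfl hgood)

/-- Every face of a polyhedron can be truncated. -/
theorem exists_truncates (hV : V.Finite) {F : Set E} (hF : IsFace (solutionSet V a b) F) :
    ∃ (c : Module.Dual ℝ E) (d : ℝ), Truncates c d (solutionSet V a b) F := by
  obtain ⟨c, d, hcd, hFeq⟩ := id hF
  have hlt : ∀ x ∈ solutionSet V a b, x ∉ F → c x < d := fun x hx hxF =>
    (hcd x hx).lt_of_ne fun h => hxF (hFeq ▸ ⟨hx, h⟩)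
  -- Push the supporting hyperplane of `F` inward by `ε`. Each requirement holds for all small `ε >
  -- 0`, and there are finitely many faces, so one `ε` serves all.
  have key : ∀ᶠ ε in 𝓝[>] (0 : ℝ), ∀ F' ∈ {F' | IsFace (solutionSet V a b) F'},
      ((F' ∩ F).Nonempty → ¬ F' ⊆ F → ({x | c x = d - ε} ∩ F').Nonempty) ∧
      (F' ∩ F = ∅ → F' ⊆ {x | c x < d - ε}) := by
    refine (finite_setOf_isFace hV).eventually_all.2 fun F' hF' => Eventually.and ?_ ?_
    · by_cases h : (F' ∩ F).Nonempty ∧ ¬ F' ⊆ F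
      · obtain ⟨⟨x, hx', hx⟩, hnot⟩ := h
        obtain ⟨y, hy', hy⟩ := Set.not_subset.1 hnot
        have hcx : c x = d := by
          rw [hFeq] at hx
          exact hx.2
        have hpos : 0 < d - c y := by linarith [hlt y (IsFace.subset hF' hy') hy]
        filter_upwards [(eventually_lt_nhds hpos).filter_mono nhdsWithin_le_nhds,
          self_mem_nhdsWithin] with ε hε hε0 _ _
        have hε0 : (0 : ℝ) < ε := hε0
        -- The point of the segment from `x` to `y` at which `c` equals `d - ε`.
        refine ⟨(1 - ε / (d - c y)) • x + (ε / (d - c y)) • y, ?_,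
          IsFace.convex convex_solutionSet hF' hx' hy' ?_ (by positivity) (by ring)⟩
        · simp only [Set.mem_ofPred_eq, map_add, map_smul, smul_eq_mul, hcx]
          field_simp
          ring
        · rw [sub_nonneg, div_le_one hpos]
          exact hε.le
      · exact Eventually.of_forall fun ε h₁ h₂ => absurd ⟨h₁, h₂⟩ h
    · by_cases h : F' ∩ F = ∅
      · rcases F'.eq_empty_or_nonempty with rfl | hne
        · exact Eventually.of_forall fun ε _ => Set.empty_subset _
        · obtain ⟨x, hx, hFx⟩ := IsFace.exists_eq_tightFace hV hF' hne
          have hc' : ∀ y ∈ tightFace V a b (activeSet V a b x), c y < d := fun y hy =>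
            hlt y hy.1 fun hyF => Set.eq_empty_iff_forall_notMem.1 h y ⟨hFx ▸ hy, hyF⟩
          filter_upwards [eventually_lt_sub_of_lt hV (activeSet_subset x) hc'] with ε hε _ y hy
          exact hε y (hFx ▸ hy)
      · exact Eventually.of_forall fun ε h' => absurd h' h
  obtain ⟨ε, hε, hε0⟩ := (key.and self_mem_nhdsWithin).exists
  have hε0 : (0 : ℝ) < ε := hε0
  refine ⟨c, d - ε, hF, fun x hx => ?_, fun F' hF' => (hε F' hF').1, fun F' hF' => (hε F' hF').2⟩
  rw [hFeq] at hx
  show d - ε < c x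
  rw [hx.2]
  linarith

/-! ### Dimensions of faces -/

/-- From `x` one can move a little in every direction killed by the active functionals without
leaving the face. -/
theorem direction_tightFace_activeSet (hV : V.Finite) {x : E} (hx : x ∈ solutionSet V a b) :
    (affineSpan ℝ (tightFace V a b (activeSet V a b x))).direction =
      (Submodule.span ℝ (a '' activeSet V a b x)).dualCoannihilator := by
  have hmem : ∀ v, v ∈ (Submodule.span ℝ (a '' activeSet V a b x)).dualCoannihilator ↔
      ∀ i ∈ activeSet V a b x, a i v = 0 := fun v => by
    rw [Submodule.mem_dualCoannihilator]
    constructor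
    · exact fun h i hi => h _ (Submodule.subset_span ⟨i, hi, rfl⟩)
    · intro h φ hφ
      induction hφ using Submodule.span_induction with
      | mem φ hφ =>
        obtain ⟨i, hi, rfl⟩ := hφ
        exact h i hi
      | zero => rfl
      | add φ ψ _ _ h₁ h₂ => rw [LinearMap.add_apply, h₁, h₂, add_zero]
      | smul r φ _ h₁ => rw [LinearMap.smul_apply, h₁, smul_zero]
  rw [direction_affineSpan]
  apply le_antisymm
  · rw [vectorSpan, Submodule.span_le]
    rintro _ ⟨y, hy, z, hz, rfl⟩
    refine (hmem _).2 fun i hi => ?_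
    simp only [vsub_eq_sub]
    rw [map_sub, hy.2 i hi, hz.2 i hi, sub_self]
  · intro v hv
    rw [hmem] at hv
    obtain ⟨t, ht, ht0⟩ := ((eventually_mem_solutionSet hV hx fun i hi => (hv i hi).le).and
      self_mem_nhdsWithin).exists
    have hy : x + t • v ∈ tightFace V a b (activeSet V a b x) := ⟨ht, fun i hi => by
      rw [map_add, map_smul, hv i hi, hi.2, smul_zero, add_zero]⟩
    have := vsub_mem_vectorSpan ℝ hy (mem_tightFace_activeSet hx)
    rw [vsub_eq_sub, add_sub_cancel_left] at this
    exact (Submodule.smul_mem_iff _ (ne_of_gt ht0)).1 this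

theorem affineDim_tightFace_activeSet [FiniteDimensional ℝ E] (hV : V.Finite) {x : E}
    (hx : x ∈ solutionSet V a b) :
    affineDim (tightFace V a b (activeSet V a b x)) +
      Module.finrank ℝ (Submodule.span ℝ (a '' activeSet V a b x)) = Module.finrank ℝ E := by
  rw [affineDim, direction_tightFace_activeSet hV hx, add_comm]
  exact Subspace.finrank_add_finrank_dualCoannihilator_eq _

/-- Linearly independent functionals take prescribed values simultaneously. -/
theorem LinearIndepOn.exists_forall_apply_eq [FiniteDimensional ℝ E] {T : Set ι}
    (h : LinearIndepOn ℝ a T) (g : ι → ℝ) : ∃ v : E, ∀ i ∈ T, a i v = g i := by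
  have hinj : Set.InjOn a T := h.injOn
  have hid : LinearIndepOn ℝ id (a '' T) := (linearIndepOn_iff_image hinj).1 h
  classical
  -- Extend the functionals to a basis of the dual, prescribe the values on it (zero off `a '' T`),
  -- and read the resulting element of the bidual as a vector.
  let f : Module.Dual ℝ E → ℝ := fun φ => if hφ : ∃ i ∈ T, a i = φ then g hφ.choose else 0
  let φ : Module.Dual ℝ (Module.Dual ℝ E) :=
    (Module.Basis.extend hid).constr ℝ fun j => f j
  refine ⟨(Module.evalEquiv ℝ E).symm φ, fun i hi => ?_⟩
  have h₁ : a i ((Module.evalEquiv ℝ E).symm φ) = φ (a i) := by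
    rw [Module.apply_evalEquiv_symm_apply]
  have hm : a i ∈ hid.extend (Set.subset_univ _) := hid.subset_extend _ ⟨i, hi, rfl⟩
  have h₂ : φ (a i) = f (a i) := by
    have := (Module.Basis.extend hid).constr_basis ℝ (fun j => f j) ⟨a i, hm⟩
    rwa [Module.Basis.extend_apply_self] at this
  have hex : ∃ j ∈ T, a j = a i := ⟨i, hi, rfl⟩
  rw [h₁, h₂]
  simp only [f, dif_pos hex]
  rw [hinj hex.choose_spec.1 hi hex.choose_spec.2]

end Systems

/-! ### Regular systems and simple polyhedra -/

section Regular

open Filter Topology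

variable {E : Type*} [AddCommGroup E] [Module ℝ E] {ι : Type*}
  {V : Set ι} {a : ι → Module.Dual ℝ E} {b : ι → ℝ}

/-- A finite solvable system of inequalities such that at each solution the active constraints are
linearly independent. -/
structure IsRegularSystem (V : Set ι) (a : ι → Module.Dual ℝ E) (b : ι → ℝ) : Prop where
  finite : V.Finite
  nonempty : (solutionSet V a b).Nonempty
  indep : ∀ x ∈ solutionSet V a b, LinearIndepOn ℝ a (activeSet V a b x)

theorem LinearIndepOn.finrank_span_image {T : Set ι} (h : LinearIndepOn ℝ a T)
    (hT : T.Finite) : (Module.finrank ℝ (Submodule.span ℝ (a '' T)) : ℕ∞) = T.encard := by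
  have := hT.fintype
  have h' := finrank_span_eq_card (R := ℝ) (b := fun i : T => a i) h
  have hr : Set.range (fun i : T => a i) = a '' T := by
    ext
    simp
  rw [hr] at h'
  rw [h', ← Set.coe_fintypeCard]

theorem isPolyhedron_solutionSet (hV : V.Finite) : IsPolyhedron (solutionSet V a b) := by
  classical
  refine ⟨hV.toFinset.image fun i => (a i, b i), ?_⟩
  ext x
  simp [solutionSet]

namespace IsRegularSystem

variable [FiniteDimensional ℝ E] (h : IsRegularSystem V a b)

include h

/-- A nonempty face of a regular system has a point at which no further constraint is active. -/
theorem exists_activeSet_eq {N : Set ι} (hN : N ⊆ V) (hne : (tightFace V a b N).Nonempty) :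
    ∃ x ∈ solutionSet V a b, activeSet V a b x = N := by
  classical
  obtain ⟨x, hx⟩ := hne
  have hNx := ((mem_tightFace_iff hN).1 hx).2
  -- Moving along `v` keeps the constraints in `N` tight and loosens all other active ones.
  obtain ⟨v, hv⟩ := (h.indep x hx.1).exists_forall_apply_eq fun i => if i ∈ N then 0 else -1
  have hle : ∀ i ∈ activeSet V a b x, a i v ≤ 0 := fun i hi => by
    rw [hv i hi]
    split_ifs <;> norm_num
  obtain ⟨t, ⟨hmem, hin⟩, ht0⟩ := (((eventually_mem_solutionSet h.finite hx.1 hle).and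
    ((eventually_inactive (a := a) (b := b) h.finite x v).filter_mono
      nhdsWithin_le_nhds)).and self_mem_nhdsWithin).exists
  have ht0 : (0 : ℝ) < t := ht0
  refine ⟨x + t • v, hmem, Set.Subset.antisymm (fun i hi => ?_) fun i hi => ⟨hN hi, ?_⟩⟩
  · by_contra hiN
    have hix : i ∈ activeSet V a b x := by
      refine ⟨hi.1, le_antisymm (hx.1 i hi.1) (not_lt.1 fun hlt => ?_)⟩
      exact (hin i hi.1 hlt).ne hi.2
    have := hi.2
    simp only [map_add, map_smul, smul_eq_mul, hv i hix, if_neg hiN, hix.2] at this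
    linarith
  · simp [hv i (hNx hi), hi, hx.2 i hi]

theorem tightFace_subset_iff {N M : Set ι} (hN : N ⊆ V) (hM : M ⊆ V)
    (hne : (tightFace V a b N).Nonempty) :
    tightFace V a b N ⊆ tightFace V a b M ↔ M ⊆ N := by
  refine ⟨fun hsub => ?_, tightFace_anti⟩
  obtain ⟨x, hx, rfl⟩ := h.exists_activeSet_eq hN hne
  exact ((mem_tightFace_iff hM).1 (hsub (mem_tightFace_activeSet hx))).2

theorem affineSpan_eq_top : affineSpan ℝ (solutionSet V a b) = ⊤ := by
  obtain ⟨x, hx, hact⟩ := h.exists_activeSet_eq (Set.empty_subset V)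
    (tightFace_empty (V := V) (a := a) (b := b) ▸ h.nonempty)
  have hd := direction_tightFace_activeSet h.finite hx
  rw [hact, tightFace_empty, Set.image_empty, Submodule.span_empty] at hd
  rw [← AffineSubspace.direction_eq_top_iff_of_nonempty (h.nonempty.affineSpan ℝ), hd]
  exact Submodule.dualCoannihilator_bot

theorem affineDim_add_encard {x : E} (hx : x ∈ solutionSet V a b) :
    (affineDim (tightFace V a b (activeSet V a b x)) : ℕ∞) + (activeSet V a b x).encard =
      (Module.finrank ℝ E : ℕ∞) := by
  rw [← (h.indep x hx).finrank_span_image (h.finite.subset (activeSet_subset x))]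
  exact_mod_cast affineDim_tightFace_activeSet h.finite hx

/-- Codimension one means exactly one active constraint at a generic point. The assumption `hV`
makes each index contribute a nonempty face. -/
theorem isFacet_iff (hV : ∀ i ∈ V, (tightFace V a b {i}).Nonempty) {G : Set E} :
    IsFacet (solutionSet V a b) G ↔ ∃ i ∈ V, tightFace V a b {i} = G := by
  constructor
  · rintro ⟨hG, hne, hdim⟩
    obtain ⟨x, hx, rfl⟩ := hG.exists_eq_tightFace h.finite hne
    have hd := h.affineDim_add_encard hx.1
    rw [← hdim, Nat.cast_add, (ENat.addLECancellable_natCast _).inj, Nat.cast_one,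
      Set.encard_eq_one] at hd
    obtain ⟨i, hi⟩ := hd
    exact ⟨i, (hi.symm ▸ rfl : i ∈ activeSet V a b x).1, by rw [hi]⟩
  · rintro ⟨i, hi, rfl⟩
    have hsub : {i} ⊆ V := Set.singleton_subset_iff.2 hi
    refine ⟨isFace_tightFace h.finite hsub, hV i hi, ?_⟩
    obtain ⟨x, hx, hact⟩ := h.exists_activeSet_eq hsub (hV i hi)
    have hd := h.affineDim_add_encard hx
    rw [hact, Set.encard_singleton] at hd
    exact_mod_cast hd

theorem injOn_tightFace (hV : ∀ i ∈ V, (tightFace V a b {i}).Nonempty) :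
    Set.InjOn (fun i => tightFace V a b {i}) V := by
  intro i hi j hj hij
  have := (h.tightFace_subset_iff (Set.singleton_subset_iff.2 hi) (Set.singleton_subset_iff.2 hj)
    (hV i hi)).1 (le_of_eq hij)
  exact (this rfl).symm

/-- The facets containing a face correspond to the constraints active at a generic point of it; by
independence their number is the codimension. -/
theorem isSimplePolyhedron (hV : ∀ i ∈ V, (tightFace V a b {i}).Nonempty) :
    IsSimplePolyhedron (solutionSet V a b) := by
  refine ⟨isPolyhedron_solutionSet h.finite, h.affineSpan_eq_top, fun F hF hne => ?_⟩
  obtain ⟨x, hx, rfl⟩ := hF.exists_eq_tightFace h.finite hne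
  have hset : {G | IsFacet (solutionSet V a b) G ∧ tightFace V a b (activeSet V a b x) ⊆ G} =
      (fun i => tightFace V a b {i}) '' activeSet V a b x := by
    ext G
    rw [Set.mem_ofPred_eq, h.isFacet_iff hV]
    constructor
    · rintro ⟨⟨i, hi, rfl⟩, hsub⟩
      exact ⟨i, ⟨hi, (hsub hx).2 i rfl⟩, rfl⟩
    · rintro ⟨i, hi, rfl⟩
      exact ⟨⟨i, hi.1, rfl⟩, tightFace_anti (Set.singleton_subset_iff.2 hi)⟩
  rw [hset, ((h.injOn_tightFace hV).mono (activeSet_subset x)).encard_image]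
  exact h.affineDim_add_encard hx.1

/-- The facets of a regular system correspond to its indices. -/
noncomputable def equivFacet (hV : ∀ i ∈ V, (tightFace V a b {i}).Nonempty) :
    V ≃ Facet (solutionSet V a b) :=
  Equiv.ofBijective
    (fun i => ⟨tightFace V a b {i.1}, (h.isFacet_iff hV).2 ⟨i.1, i.2, rfl⟩⟩)
    ⟨fun i j hij => Subtype.ext (h.injOn_tightFace hV i.2 j.2 (congrArg Subtype.val hij)),
      fun G => by
        obtain ⟨i, hi, hG⟩ := (h.isFacet_iff hV).1 G.2
        exact ⟨⟨i, hi⟩, Subtype.ext hG⟩⟩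

theorem faceOf_map_equivFacet (hV : ∀ i ∈ V, (tightFace V a b {i}).Nonempty) (S : Finset V) :
    faceOf (solutionSet V a b) (S.map (h.equivFacet hV).toEmbedding) =
      tightFace V a b (Subtype.val '' (S : Set V)) := by
  ext x
  refine and_congr_right fun hx => ?_
  constructor
  · rintro hS _ ⟨i, hi, rfl⟩
    exact (hS _ (Finset.mem_map_of_mem _ hi) : x ∈ tightFace V a b {i.1}).2 _ rfl
  · intro hS s hs
    obtain ⟨i, hi, rfl⟩ := Finset.mem_map.1 hs
    refine (⟨hx, ?_⟩ : x ∈ tightFace V a b {i.1})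
    rintro j rfl
    exact hS i ⟨i, hi, rfl⟩

/-- The dual complex of a regular system records which sets of constraints are simultaneously
active. -/
theorem simplicialIsomorphic (hV : ∀ i ∈ V, (tightFace V a b {i}).Nonempty)
    (K : AbstractSimplicialComplex V) (hK : ∀ S : Finset V, S ∈ K.faces ↔
      S.Nonempty ∧ (tightFace V a b (Subtype.val '' (S : Set V))).Nonempty) :
    SimplicialIsomorphic (dualComplex (solutionSet V a b)) K := by
  refine ⟨(h.equivFacet hV).symm, fun S => ?_⟩
  rw [hK, ← h.faceOf_map_equivFacet hV, Finset.map_map]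
  have : (h.equivFacet hV).symm.toEmbedding.trans (h.equivFacet hV).toEmbedding =
      Function.Embedding.refl _ := by
    ext
    simp
  rw [this, Finset.map_refl, Finset.map_nonempty]
  rfl

end IsRegularSystem

/-! ### Irredundant descriptions of simple polyhedra -/

/-- A full-dimensional polyhedron is the solution set of a finite system of inequalities none of
which can be left out. -/
theorem IsPolyhedron.exists_irredundant {P : Set E} (hP : IsPolyhedron P)
    (htop : affineSpan ℝ P = ⊤) :
    ∃ H : Set (Module.Dual ℝ E × ℝ), H.Finite ∧ P = solutionSet H Prod.fst Prod.snd ∧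
      ∀ h ∈ H, h.1 ≠ 0 ∧ ∃ w ∈ P, activeSet H Prod.fst Prod.snd w = {h} := by
  classical
  obtain ⟨H, hH, hmin⟩ := exists_minimalFor_of_wellFoundedLT
    (fun H : Finset (Module.Dual ℝ E × ℝ) => P = {x | ∀ h ∈ H, h.1 x ≤ h.2}) Finset.card hP
  have hPH : P = solutionSet (H : Set (Module.Dual ℝ E × ℝ)) Prod.fst Prod.snd := hH
  have hne : P.Nonempty := by
    by_contra hcon
    rw [Set.not_nonempty_iff_eq_empty.1 hcon, AffineSubspace.span_empty] at htop
    exact AffineSubspace.bot_ne_top ℝ E E htop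
  have hirr : ∀ h ∈ H, ∃ y, (∀ k ∈ H, k ≠ h → k.1 y ≤ k.2) ∧ h.2 < h.1 y := by
    intro h hh
    by_contra! hcon
    have : P = {x | ∀ k ∈ H.erase h, k.1 x ≤ k.2} := by
      rw [hH]
      ext x
      refine ⟨fun hx k hk => hx k (Finset.mem_of_mem_erase hk), fun hx k hk => ?_⟩
      have hx' : ∀ k ∈ H, k ≠ h → k.1 x ≤ k.2 := fun k hk hkh =>
        hx k (Finset.mem_erase.2 ⟨hkh, hk⟩)
      by_cases hkh : k = h
      · exact hkh ▸ hcon x hx'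
      · exact hx' k hk hkh
    have := hmin this (Finset.card_le_card (Finset.erase_subset _ _))
    exact absurd (Finset.card_erase_lt_of_mem hh) (not_lt.2 this)
  have hnz : ∀ h ∈ H, h.1 ≠ 0 := by
    intro h hh h0
    obtain ⟨y, -, hy⟩ := hirr h hh
    obtain ⟨x, hx⟩ := hne
    rw [hH] at hx
    have := hx h hh
    rw [h0] at this hy
    exact absurd hy (not_lt.2 this)
  obtain ⟨z, hz, hzmin⟩ := exists_activeSet_minimal (V := (H : Set (Module.Dual ℝ E × ℝ)))
    (a := Prod.fst) (b := Prod.snd) H.finite_toSet hPH.le (hPH ▸ convex_solutionSet) hne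
  -- A constraint active at `z` would be active on all of `P` by minimality, so its functional would
  -- vanish on the direction space, which is all of `E`.
  have hzint : ∀ h ∈ H, h.1 z < h.2 := by
    intro h hh
    refine lt_of_le_of_ne (by rw [hH] at hz; exact hz h hh) fun heq => hnz h hh ?_
    have hker : vectorSpan ℝ P ≤ LinearMap.ker h.1 := by
      rw [vectorSpan, Submodule.span_le]
      rintro _ ⟨x, hx, y, hy, rfl⟩
      have h₁ := (hzmin x hx (⟨hh, heq⟩ : h ∈ activeSet _ _ _ z)).2
      have h₂ := (hzmin y hy (⟨hh, heq⟩ : h ∈ activeSet _ _ _ z)).2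
      simp only [vsub_eq_sub, SetLike.mem_coe, LinearMap.mem_ker]
      rw [map_sub, h₁, h₂, sub_self]
    rw [← direction_affineSpan, htop, AffineSubspace.direction_top, top_le_iff,
      LinearMap.ker_eq_top] at hker
    exact hker
  refine ⟨H, H.finite_toSet, hPH, fun h hh => ⟨hnz h hh, ?_⟩⟩
  obtain ⟨y, hy, hyh⟩ := hirr h hh
  have hzh := hzint h hh
  have hpos : 0 < h.1 y - h.1 z := by linarith
  -- The segment from the interior point `z` to `y`, which violates `h` alone, crosses the
  -- hyperplane of `h` at parameter `t`, where all other constraints are strict.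
  set t := (h.2 - h.1 z) / (h.1 y - h.1 z) with ht
  have ht0 : 0 < t := div_pos (by linarith) hpos
  have ht1 : t < 1 := (div_lt_one hpos).2 (by linarith)
  have hw : h.1 ((1 - t) • z + t • y) = h.2 := by
    have : t * (h.1 y - h.1 z) = h.2 - h.1 z := div_mul_cancel₀ _ hpos.ne'
    simp only [map_add, map_smul, smul_eq_mul]
    linarith
  have hother : ∀ k ∈ H, k ≠ h → k.1 ((1 - t) • z + t • y) < k.2 := by
    intro k hk hkh
    have h₁ := mul_lt_mul_of_pos_left (hzint k hk) (sub_pos.2 ht1)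
    have h₂ := mul_le_mul_of_nonneg_left (hy k hk hkh) ht0.le
    simp only [map_add, map_smul, smul_eq_mul]
    linarith
  refine ⟨(1 - t) • z + t • y, ?_, ?_⟩
  · rw [hH]
    intro k hk
    by_cases hkh : k = h
    · exact hkh ▸ hw.le
    · exact (hother k hk hkh).le
  · ext k
    constructor
    · intro hk
      by_contra hkh
      exact (hother k hk.1 hkh).ne hk.2
    · rintro rfl
      exact ⟨hh, hw⟩

/-- A simple polyhedron is described by a regular system indexed by its facets. -/
theorem IsSimplePolyhedron.exists_isRegularSystem [FiniteDimensional ℝ E] {P : Set E}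
    (hP : IsSimplePolyhedron P) :
    ∃ (a : Facet P → Module.Dual ℝ E) (b : Facet P → ℝ), P = solutionSet Set.univ a b ∧
      IsRegularSystem Set.univ a b ∧ ∀ s : Facet P, s.1 = {x ∈ P | a s x = b s} := by
  obtain ⟨H, hfin, hPH, hirr⟩ := hP.1.exists_irredundant hP.2.1
  set fst : Module.Dual ℝ E × ℝ → Module.Dual ℝ E := Prod.fst
  set snd : Module.Dual ℝ E × ℝ → ℝ := Prod.snd
  have hfacet : ∀ G, IsFacet P G ↔ ∃ h ∈ H, tightFace H fst snd {h} = G := by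
    intro G
    constructor
    · rintro ⟨hG, hne, hdim⟩
      rw [hPH] at hG
      obtain ⟨x, hx, rfl⟩ := hG.exists_eq_tightFace hfin hne
      have hd := affineDim_tightFace_activeSet hfin hx.1
      rw [← hdim, Nat.add_left_cancel_iff] at hd
      have hne : (activeSet H fst snd x).Nonempty := by
        by_contra hcon
        rw [Set.not_nonempty_iff_eq_empty.1 hcon, Set.image_empty, Submodule.span_empty,
          finrank_bot] at hd
        exact zero_ne_one hd
      obtain ⟨h, hh⟩ := hne
      -- On a facet the active functionals have rank one, so all are multiples of `h.1` and the
      -- constraint `h` alone cuts out the facet.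
      have hspan : Submodule.span ℝ {h.1} = Submodule.span ℝ (fst '' activeSet H fst snd x) := by
        refine Submodule.eq_of_le_of_finrank_eq (Submodule.span_mono ?_) ?_
        · exact Set.singleton_subset_iff.2 ⟨h, hh, rfl⟩
        · rw [hd, finrank_span_singleton (hirr h hh.1).1]
      refine ⟨h, hh.1, Set.Subset.antisymm (fun y hy => ⟨hy.1, fun k hk => ?_⟩)
        (tightFace_anti (Set.singleton_subset_iff.2 hh))⟩
      have hk' : k.1 ∈ Submodule.span ℝ {h.1} :=
        hspan ▸ Submodule.subset_span ⟨k, hk, rfl⟩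
      obtain ⟨r, hr⟩ := Submodule.mem_span_singleton.1 hk'
      have h₁ : h.1 y = h.2 := hy.2 h rfl
      have h₂ : h.1 x = h.2 := hh.2
      have h₃ : k.1 x = k.2 := hk.2
      show k.1 y = k.2
      rw [← h₃, ← hr, LinearMap.smul_apply, LinearMap.smul_apply, h₁, h₂]
    · rintro ⟨h, hh, rfl⟩
      obtain ⟨hnz, w, hw, hact⟩ := hirr h hh
      rw [hPH] at hw ⊢
      refine ⟨isFace_tightFace hfin (Set.singleton_subset_iff.2 hh),
        ⟨w, hact ▸ mem_tightFace_activeSet hw⟩, ?_⟩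
      have hd := affineDim_tightFace_activeSet hfin hw
      rwa [hact, Set.image_singleton, finrank_span_singleton hnz] at hd
  have hinj : Set.InjOn (fun h => tightFace H fst snd {h}) H := by
    intro h hh k hk heq
    obtain ⟨-, w, hw, hact⟩ := hirr h hh
    have hmem : w ∈ tightFace H fst snd {h} := hact ▸ mem_tightFace_activeSet (hPH ▸ hw)
    have : k ∈ activeSet H fst snd w := ⟨hk, (heq.subset hmem).2 k rfl⟩
    rw [hact] at this
    exact this.symm
  choose g hgH hg using fun s : Facet P => (hfacet s.1).1 s.2
  have hginj : Function.Injective g := fun s t hst => Subtype.ext (by rw [← hg s, ← hg t, hst])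
  have hgsurj : ∀ h ∈ H, ∃ s, g s = h := fun h hh =>
    ⟨⟨_, (hfacet _).2 ⟨h, hh, rfl⟩⟩, hinj (hgH _) hh (hg _)⟩
  have hsol : P = solutionSet Set.univ (fun s => (g s).1) (fun s => (g s).2) := by
    refine hPH.trans ?_
    ext x
    refine ⟨fun hx s _ => hx _ (hgH s), fun hx h hh => ?_⟩
    obtain ⟨s, rfl⟩ := hgsurj h hh
    exact hx s trivial
  have hact : ∀ x, g '' activeSet Set.univ (fun s => (g s).1) (fun s => (g s).2) x =
      activeSet H fst snd x := by
    intro x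
    ext h
    constructor
    · rintro ⟨s, hs, rfl⟩
      exact ⟨hgH s, hs.2⟩
    · intro hh
      obtain ⟨s, rfl⟩ := hgsurj h hh.1
      exact ⟨s, ⟨trivial, hh.2⟩, rfl⟩
  have hfinH : Finite H := hfin
  have hfinF : Finite (Facet P) :=
    Finite.of_injective (fun s => (⟨g s, hgH s⟩ : H)) (fun s t hst =>
      hginj (congrArg Subtype.val hst))
  refine ⟨fun s => (g s).1, fun s => (g s).2, hsol, ⟨Set.finite_univ, ?_, ?_⟩, ?_⟩
  · rw [← hsol]
    by_contra hcon
    have htop := hP.2.1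
    rw [Set.not_nonempty_iff_eq_empty.1 hcon, AffineSubspace.span_empty] at htop
    exact AffineSubspace.bot_ne_top ℝ E E htop
  · intro x hx
    rw [← hsol] at hx
    have hx' : x ∈ solutionSet H fst snd := hPH ▸ hx
    have hd := affineDim_tightFace_activeSet hfin hx'
    have hface : IsFace P (tightFace H fst snd (activeSet H fst snd x)) := by
      rw [hPH]
      exact isFace_tightFace hfin (activeSet_subset x)
    -- Simplicity equates the number of facets through this face with its codimension, which is the
    -- rank of the active functionals. Number equal to rank gives independence.
    have hs := hP.2.2 _ hface ⟨x, mem_tightFace_activeSet hx'⟩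
    have hset : {G | IsFacet P G ∧ tightFace H fst snd (activeSet H fst snd x) ⊆ G} =
        (fun h => tightFace H fst snd {h}) '' activeSet H fst snd x := by
      ext G
      rw [Set.mem_ofPred_eq, hfacet]
      constructor
      · rintro ⟨⟨h, hh, rfl⟩, hsub⟩
        exact ⟨h, ⟨hh, (hsub (mem_tightFace_activeSet hx')).2 h rfl⟩, rfl⟩
      · rintro ⟨h, hh, rfl⟩
        exact ⟨⟨h, hh.1, rfl⟩, tightFace_anti (Set.singleton_subset_iff.2 hh)⟩
    have hcard : (activeSet H fst snd x).encard =
        (activeSet Set.univ (fun s => (g s).1) (fun s => (g s).2) x).encard := by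
      rw [← hact, hginj.encard_image]
    rw [hset, (hinj.mono (activeSet_subset x)).encard_image, ← hd, Nat.cast_add,
      (ENat.addLECancellable_natCast _).inj, hcard, ← hact, Set.image_image] at hs
    have := Fintype.ofFinite
      (activeSet Set.univ (fun s => (g s).1) (fun s => (g s).2) x : Set (Facet P))
    rw [LinearIndepOn, linearIndependent_iff_card_eq_finrank_span, Set.finrank]
    rw [← Set.coe_fintypeCard] at hs
    have hr : Set.range (fun i : activeSet Set.univ (fun s => (g s).1) (fun s => (g s).2) x =>
        (g i).1) = (fun s => fst (g s)) '' activeSet Set.univ (fun s => (g s).1)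
          (fun s => (g s).2) x := by
      ext
      simp [fst]
    rw [hr]
    exact_mod_cast hs
  · intro s
    rw [← hg s]
    ext x
    rw [tightFace, ← hPH]
    simp [fst, snd]

end Regular

/-! ### Truncating a regular system -/

section Truncation

variable {E : Type*} [AddCommGroup E] [Module ℝ E] {ι : Type*}
  {V : Set ι} {a : ι → Module.Dual ℝ E} {b : ι → ℝ}

theorem Truncates.not_subset {α : Module.Dual ℝ E} {β : ℝ} {σ N : Set ι}
    (ht : Truncates α β (solutionSet V a b) (tightFace V a b σ)) {x : E}
    (hx : x ∈ tightFace V a b N) (hxα : α x ≤ β) : ¬ σ ⊆ N := fun hsub =>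
  absurd hxα (not_le.2 (ht.face_subset (tightFace_anti hsub hx)))

variable [FiniteDimensional ℝ E]

namespace IsRegularSystem

variable (h : IsRegularSystem V a b) {α : Module.Dual ℝ E} {β : ℝ} {σ : Set ι} (hσ : σ ⊆ V)
  (ht : Truncates α β (solutionSet V a b) (tightFace V a b σ))

include h hσ ht

/-- A face inside the truncated one is cut off. Any other nonempty face keeps a point: by `meets` if
it touches the truncated face, by `avoids` if not. -/
theorem tightFace_inter_halfspace_nonempty_iff {N : Set ι} (hN : N ⊆ V) :
    (tightFace V a b N ∩ {x | α x ≤ β}).Nonempty ↔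
      (tightFace V a b N).Nonempty ∧ ¬ σ ⊆ N := by
  constructor
  · rintro ⟨x, hx, hxα⟩
    exact ⟨⟨x, hx⟩, ht.not_subset hx hxα⟩
  · rintro ⟨hne, hnot⟩
    have hface := isFace_tightFace (a := a) (b := b) h.finite hN
    by_cases hmeet : (tightFace V a b N ∩ tightFace V a b σ).Nonempty
    · obtain ⟨x, hx, hxN⟩ :=
        ht.meets _ hface hmeet fun hsub => hnot ((h.tightFace_subset_iff hN hσ hne).1 hsub)
      exact ⟨x, hxN, le_of_eq hx⟩
    · obtain ⟨x, hx⟩ := hne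
      have hx' := ht.avoids _ hface (Set.not_nonempty_iff_eq_empty.1 hmeet) hx
      exact ⟨x, hx, (le_of_lt hx' : α x ≤ β)⟩

/-- The new facet meets precisely the faces that touch the truncated face without lying in it. With
the half-space version this describes the stellar subdivision. -/
theorem tightFace_inter_hyperplane_nonempty_iff {N : Set ι} (hN : N ⊆ V) :
    (tightFace V a b N ∩ {x | α x = β}).Nonempty ↔
      (tightFace V a b (N ∪ σ)).Nonempty ∧ ¬ σ ⊆ N := by
  have hface := isFace_tightFace (a := a) (b := b) h.finite hN
  rw [tightFace_union]
  constructor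
  · rintro ⟨x, hx, hxα⟩
    refine ⟨?_, ht.not_subset hx (le_of_eq hxα)⟩
    by_contra hmeet
    exact (ht.avoids _ hface (Set.not_nonempty_iff_eq_empty.1 hmeet) hx).ne hxα
  · rintro ⟨hmeet, hnot⟩
    obtain ⟨x, hx, hxN⟩ := ht.meets _ hface hmeet fun hsub =>
      hnot ((h.tightFace_subset_iff hN hσ (hmeet.mono Set.inter_subset_left)).1 hsub)
    exact ⟨x, hxN, hx⟩

variable [DecidableEq ι] (hne : σ.Nonempty) {s : ι} (hs : σ = {s} ∨ s ∉ V)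

include hne hs

/-- The point is the case `σ = {s}`, where the new inequality replaces the old one at `s`, which
must be redundant. Otherwise a segment from a surviving solution `z` to a violator `x` would cross
the facet at `s` with `α ≤ β`, although truncation demands `α > β` there. -/
theorem solutionSet_insert_update :
    solutionSet (insert s V) (Function.update a s α) (Function.update b s β) =
      solutionSet V a b ∩ {x | α x ≤ β} := by
  ext x
  constructor
  · intro hx
    have hxα : α x ≤ β := by simpa using hx s (Set.mem_insert _ _)
    have hxi : ∀ i ∈ V, i ≠ s → a i x ≤ b i := fun i hi his => by
      simpa [his] using hx i (Set.mem_insert_of_mem _ hi)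
    refine ⟨fun i hi => ?_, hxα⟩
    by_cases his : i = s
    swap
    · exact hxi i hi his
    subst his
    rcases hs with rfl | hs
    swap
    · exact absurd hi hs
    by_contra! hlt
    obtain ⟨z, hz, hzα⟩ := (h.tightFace_inter_halfspace_nonempty_iff hσ ht
      (Set.empty_subset V)).2 ⟨by rw [tightFace_empty]; exact h.nonempty, by simp⟩
    rw [tightFace_empty] at hz
    have hzα : α z ≤ β := hzα
    have hzi : a i z < b i := lt_of_le_of_ne (hz i hi) fun heq =>
      absurd hzα (not_le.2 (ht.face_subset ⟨hz, by rintro j rfl; exact heq⟩))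
    have hpos : 0 < a i x - a i z := by linarith
    set t := (b i - a i z) / (a i x - a i z) with htdef
    have ht0 : 0 < t := div_pos (by linarith) hpos
    have ht1 : t < 1 := (div_lt_one hpos).2 (by linarith)
    have hw : a i ((1 - t) • z + t • x) = b i := by
      have : t * (a i x - a i z) = b i - a i z := div_mul_cancel₀ _ hpos.ne'
      simp only [map_add, map_smul, smul_eq_mul]
      linarith
    have hmem : (1 - t) • z + t • x ∈ tightFace V a b {i} := by
      refine ⟨fun j hj => ?_, by rintro j rfl; exact hw⟩
      by_cases hji : j = i
      · exact hji ▸ hw.le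
      · have h₁ := mul_le_mul_of_nonneg_left (hz j hj) (sub_pos.2 ht1).le
        have h₂ := mul_le_mul_of_nonneg_left (hxi j hj hji) ht0.le
        simp only [map_add, map_smul, smul_eq_mul]
        linarith
    have hgt : β < α ((1 - t) • z + t • x) := ht.face_subset hmem
    have h₁ := mul_le_mul_of_nonneg_left hzα (sub_pos.2 ht1).le
    have h₂ := mul_le_mul_of_nonneg_left hxα ht0.le
    simp only [map_add, map_smul, smul_eq_mul] at hgt
    linarith
  · rintro ⟨hx, hxα⟩ i hi
    by_cases his : i = s
    · subst his
      simpa using hxα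
    · simpa [his] using hx i (hi.resolve_left his)

theorem tightFace_insert_update {N : Set ι} (hsN : s ∉ N) :
    tightFace (insert s V) (Function.update a s α) (Function.update b s β) N =
      tightFace V a b N ∩ {x | α x ≤ β} := by
  have hN : ∀ i ∈ N, i ≠ s := fun i hi his => hsN (his ▸ hi)
  ext x
  rw [tightFace, h.solutionSet_insert_update hσ ht hne hs]
  constructor
  · rintro ⟨⟨hx, hxα⟩, hxN⟩
    exact ⟨⟨hx, fun i hi => by simpa [hN i hi] using hxN i hi⟩, hxα⟩
  · rintro ⟨⟨hx, hxN⟩, hxα⟩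
    exact ⟨⟨hx, hxα⟩, fun i hi => by simpa [hN i hi] using hxN i hi⟩

theorem tightFace_insert_update_insert {N : Set ι} (hsN : s ∉ N) :
    tightFace (insert s V) (Function.update a s α) (Function.update b s β) (insert s N) =
      tightFace V a b N ∩ {x | α x = β} := by
  have hN : ∀ i ∈ N, i ≠ s := fun i hi his => hsN (his ▸ hi)
  ext x
  rw [tightFace, h.solutionSet_insert_update hσ ht hne hs]
  constructor
  · rintro ⟨⟨hx, hxα⟩, hxN⟩
    exact ⟨⟨hx, fun i hi => by simpa [hN i hi] using hxN i (Set.mem_insert_of_mem _ hi)⟩,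
      by simpa using hxN s (Set.mem_insert _ _)⟩
  · rintro ⟨⟨hx, hxN⟩, hxα⟩
    refine ⟨⟨hx, le_of_eq hxα⟩, fun i hi => ?_⟩
    rcases hi with rfl | hi
    · simpa using hxα
    · simpa [hN i hi] using hxN i hi

/-- Only the independence of `α` at a point `x` of the new hyperplane is at stake. If `α` were in
the span of the other active functionals `M`, it would be constant on the face of `M`; but that face
reaches the truncated face, where `α > β`. -/
theorem insert_update :
    IsRegularSystem (insert s V) (Function.update a s α) (Function.update b s β) := by
  have hsol := h.solutionSet_insert_update hσ ht hne hs
  refine ⟨h.finite.insert s, ?_, fun x hx => ?_⟩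
  · rw [hsol, ← tightFace_empty, h.tightFace_inter_halfspace_nonempty_iff hσ ht
      (Set.empty_subset V), tightFace_empty]
    exact ⟨h.nonempty, fun hsub => hne.ne_empty (Set.subset_empty_iff.1 hsub)⟩
  · rw [hsol] at hx
    obtain ⟨hx, hxα⟩ := hx
    set M := activeSet V a b x \ {s} with hM
    have hMV : M ⊆ V := fun i hi => hi.1.1
    have heq : Set.EqOn a (Function.update a s α) M := fun i hi => by
      rw [Function.update_of_ne hi.2]
    have hMind : LinearIndepOn ℝ (Function.update a s α) M :=
      ((h.indep x hx).mono Set.sdiff_subset).congr heq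
    by_cases hβ : α x = β
    · have hact : activeSet (insert s V) (Function.update a s α) (Function.update b s β) x =
          insert s M := by
        ext i
        by_cases his : i = s
        · subst his
          simp [activeSet, hβ]
        · simp [activeSet, hM, his]
      rw [hact]
      refine hMind.insert ?_
      rw [Function.update_self, ← heq.image_eq]
      intro hspan
      have hxM : x ∈ tightFace V a b M := ⟨hx, fun i hi => hi.1.2⟩
      obtain ⟨y, hy⟩ := ((h.tightFace_inter_hyperplane_nonempty_iff hσ ht hMV).1
        ⟨x, hxM, hβ⟩).1
      rw [tightFace_union] at hy
      have hker : ∀ φ ∈ Submodule.span ℝ (a '' M), φ y = φ x := by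
        intro φ hφ
        induction hφ using Submodule.span_induction with
        | mem φ hφ =>
          obtain ⟨i, hi, rfl⟩ := hφ
          rw [hxM.2 i hi, hy.1.2 i hi]
        | zero => rfl
        | add φ ψ _ _ h₁ h₂ => rw [LinearMap.add_apply, h₁, h₂, LinearMap.add_apply]
        | smul r φ _ h₁ => rw [LinearMap.smul_apply, h₁, LinearMap.smul_apply]
      have : β < α y := ht.face_subset hy.2
      rw [hker α hspan, hβ] at this
      exact lt_irrefl _ this
    · have hact : activeSet (insert s V) (Function.update a s α) (Function.update b s β) x =
          M := by
        ext i
        by_cases his : i = s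
        · subst his
          simp [activeSet, hβ, hM]
        · simp [activeSet, hM, his]
      rwa [hact]

end IsRegularSystem

end Truncation

/-! ### Building sets and nested sets of face posets -/

section Combinatorics

variable {ι : Type*} {K : AbstractSimplicialComplex ι}

theorem IsNested.mono {L : Type*} [SemilatticeInf L] [OrderBot L] {B N M : Set L}
    (h : IsNested B N) (hM : M ⊆ N) : IsNested B M :=
  ⟨hM.trans h.1, fun N' hN' => h.2 N' (hN'.trans hM)⟩

namespace FacePoset

theorem exists_val_eq (S : FacePoset K) {s : Finset ι} (hs : s ⊆ S.1) :
    ∃ T : FacePoset K, T.1 = s := by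
  rcases s.eq_empty_or_nonempty with h | h
  · exact ⟨⟨s, Or.inl h⟩, rfl⟩
  · refine ⟨⟨s, Or.inr ?_⟩, rfl⟩
    rcases S.2 with hS | hS
    · rw [hS, Finset.subset_empty] at hs
      exact absurd hs h.ne_empty
    · exact (K.isRelLowerSet_faces hS).2 hs h

theorem exists_singleton {S : FacePoset K} {p : ι} (hp : p ∈ S.1) :
    ∃ T : FacePoset K, T.1 = {p} := S.exists_val_eq (Finset.singleton_subset_iff.2 hp)

/-- Subsets of faces are faces, so the union of a bounded family is a face and is its join. -/
theorem exists_isLUB {N : Set (FacePoset K)} {u : FacePoset K} (hu : u ∈ upperBounds N) :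
    ∃ z, IsLUB N z ∧ ∀ p, p ∈ z.1 ↔ ∃ T ∈ N, p ∈ T.1 := by
  classical
  obtain ⟨z, hz⟩ := u.exists_val_eq (Finset.filter_subset (fun p => ∃ T ∈ N, p ∈ T.1) u.1)
  have hmem : ∀ p, p ∈ z.1 ↔ ∃ T ∈ N, p ∈ T.1 := fun p => by
    rw [hz, Finset.mem_filter, and_iff_right_iff_imp]
    rintro ⟨T, hT, hp⟩
    exact hu hT hp
  refine ⟨z, ⟨fun T hT p hp => (hmem p).2 ⟨T, hT, hp⟩, fun w hw p hp => ?_⟩, hmem⟩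
  obtain ⟨T, hT, hpT⟩ := (hmem p).1 hp
  exact hw hT hpT

theorem _root_.IsLUB.mem_facePoset_iff {N : Set (FacePoset K)} {z : FacePoset K}
    (hz : IsLUB N z) (p : ι) : p ∈ z.1 ↔ ∃ T ∈ N, p ∈ T.1 := by
  obtain ⟨w, hw, hmem⟩ := exists_isLUB hz.1
  rw [hz.unique hw, hmem]

theorem eq_of_le_of_card_eq_one {S T : FacePoset K} (h : S ≤ T) (hS : S.1.card = 1)
    (hT : T.1.card = 1) : S = T :=
  Subtype.ext (Finset.eq_of_subset_of_card_le h (by rw [hS, hT]))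

/-- The vertices of a face. -/
def vertices (S : FacePoset K) : Set (FacePoset K) := {T | T.1.card = 1 ∧ T ≤ S}

theorem isLUB_vertices (S : FacePoset K) : IsLUB S.vertices S := by
  refine ⟨fun T hT => hT.2, fun w hw p hp => ?_⟩
  obtain ⟨T, hT⟩ := exists_singleton hp
  have hTS : T ∈ S.vertices := by
    refine ⟨by rw [hT, Finset.card_singleton], fun q hq => ?_⟩
    rw [hT, Finset.mem_singleton] at hq
    exact hq ▸ hp
  exact hw hTS (hT ▸ Finset.mem_singleton_self p : p ∈ T.1)

theorem vertices_eq_singleton {S : FacePoset K} (hS : S.1.card = 1) : S.vertices = {S} := by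
  ext T
  constructor
  · exact fun hT => eq_of_le_of_card_eq_one hT.2 hT.1 hS
  · rintro rfl
    exact ⟨hS, le_rfl⟩

theorem isAntichain_vertices (S : FacePoset K) : IsAntichain (· ≤ ·) S.vertices :=
  fun _ hT _ hT' hne hle => hne (eq_of_le_of_card_eq_one hle hT.1 hT'.1)

theorem nontrivial_vertices {S : FacePoset K} (hS : 1 < S.1.card) : S.vertices.Nontrivial := by
  obtain ⟨p, hp, q, hq, hpq⟩ := Finset.one_lt_card.1 hS
  obtain ⟨T, hT⟩ := exists_singleton hp
  obtain ⟨T', hT'⟩ := exists_singleton hq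
  refine ⟨T, ⟨by rw [hT, Finset.card_singleton], ?_⟩, T',
    ⟨by rw [hT', Finset.card_singleton], ?_⟩, fun h => hpq ?_⟩
  · exact (hT.trans_le (Finset.singleton_subset_iff.2 hp) : T.1 ≤ S.1)
  · exact (hT'.trans_le (Finset.singleton_subset_iff.2 hq) : T'.1 ≤ S.1)
  · rw [h, hT'] at hT
    exact (Finset.singleton_inj.1 hT).symm

/-- A set of faces is closed under unions, as far as they are faces, of faces that intersect. -/
def IsUnionClosed (V : Set (FacePoset K)) : Prop :=
  ∀ S ∈ V, ∀ T ∈ V, ∀ J : FacePoset K, (∃ p ∈ S.1, p ∈ T.1) →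
    (∀ p, p ∈ J.1 ↔ p ∈ S.1 ∨ p ∈ T.1) → J ∈ V

/-! ### Nested sets after adjoining one face -/

section Adjoin

variable {V N : Set (FacePoset K)} {S : FacePoset K}
  (hmin : ∀ T ∈ V, T ≤ S → T.1.card = 1 ∨ T = S) (hS : S.1.card ≠ 1 → 1 < S.1.card ∧ S ∉ V)
  (hsing : ∀ T : FacePoset K, T.1.card = 1 → T ∈ V) (hSN : S ∉ N)

include hmin hS hsing hSN

/-- The nested sets without `S`, after adjoining `S`. -/
theorem isNested_insert_iff_of_notMem :
    (N ⊆ V ∧ IsNested (insert S V) N) ↔ IsNested V N ∧ ¬ S.vertices ⊆ N := by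
  -- A vertex is already in `V`: nothing is adjoined, matching a truncation at a facet.
  by_cases hcard : S.1.card = 1
  · rw [Set.insert_eq_of_mem (hsing S hcard), vertices_eq_singleton hcard,
      Set.singleton_subset_iff]
    exact ⟨fun h => ⟨h.2, hSN⟩, fun h => ⟨h.1.1, h.1⟩⟩
  obtain ⟨hcard, hSV⟩ := hS hcard
  constructor
  · rintro ⟨hNV, h⟩
    refine ⟨⟨hNV, fun N' hN' ha hn => ?_⟩, fun hsub => ?_⟩
    · obtain ⟨z, hz, hzV⟩ := h.2 N' hN' ha hn
      exact ⟨z, hz, fun hV => hzV (Set.mem_insert_of_mem _ hV)⟩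
    · obtain ⟨z, hz, hzV⟩ := h.2 _ hsub S.isAntichain_vertices (nontrivial_vertices hcard)
      exact hzV (Or.inl (hz.unique S.isLUB_vertices))
  · rintro ⟨h, hnot⟩
    refine ⟨h.1, h.1.trans (Set.subset_insert _ _), fun N' hN' ha hn => ?_⟩
    obtain ⟨z, hz, hzV⟩ := h.2 N' hN' ha hn
    refine ⟨z, hz, ?_⟩
    rintro (rfl | hV)
    swap
    · exact hzV hV
    -- If the join is `S`, the members of `N'` are vertices of `S` covering it, so `N` contains them
    -- all.
    have hone : ∀ T ∈ N', T.1.card = 1 := fun T hT =>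
      (hmin T (h.1 (hN' hT)) (hz.1 hT)).resolve_right fun heq => hSN (heq ▸ hN' hT)
    refine hnot fun T hT => ?_
    obtain ⟨p, hp⟩ := Finset.card_eq_one.1 hT.1
    obtain ⟨T', hT', hpT'⟩ := (hz.mem_facePoset_iff p).1
      (hT.2 (hp ▸ Finset.mem_singleton_self p : p ∈ T.1))
    have hle : T ≤ T' := (hp.trans_le (Finset.singleton_subset_iff.2 hpT') : T.1 ≤ T'.1)
    rw [eq_of_le_of_card_eq_one hle hT.1 (hone T' hT')]
    exact hN' hT'

/-- The nested sets with `S`, after adjoining `S`. -/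
theorem isNested_insert_insert_iff (hcl : IsUnionClosed (insert S V)) :
    (N ⊆ V ∧ IsNested (insert S V) (insert S N)) ↔
      IsNested V (N ∪ S.vertices) ∧ ¬ S.vertices ⊆ N := by
  have hiff := isNested_insert_iff_of_notMem hmin hS hsing hSN
  have hvV : S.vertices ⊆ V := fun T hT => hsing T hT.1
  by_cases hcard : S.1.card = 1
  · rw [Set.insert_eq_of_mem (hsing S hcard), vertices_eq_singleton hcard,
      Set.singleton_subset_iff, Set.union_singleton]
    exact ⟨fun h => ⟨h.2, hSN⟩, fun h => ⟨(Set.subset_insert _ _).trans h.1.1, h.1⟩⟩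
  obtain ⟨hcard, hSV⟩ := hS hcard
  constructor
  · rintro ⟨hNV, h⟩
    refine ⟨⟨Set.union_subset hNV hvV, fun N' hN' ha hn => ?_⟩,
      (hiff.1 ⟨hNV, h.mono (Set.subset_insert _ _)⟩).2⟩
    by_cases hN'N : N' ⊆ N
    · obtain ⟨z, hz, hzV⟩ := h.2 N' (hN'N.trans (Set.subset_insert _ _)) ha hn
      exact ⟨z, hz, fun hV => hzV (Set.mem_insert_of_mem _ hV)⟩
    obtain ⟨T₀, hT₀, hT₀N⟩ := Set.not_subset.1 hN'N
    have hT₀S : T₀ ∈ S.vertices := (hN' hT₀).resolve_left hT₀N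
    have hone : ∀ T ∈ N', T ≤ S → T.1.card = 1 := fun T hT hTS => by
      have hTV : T ∈ V := Set.union_subset hNV hvV (hN' hT)
      exact (hmin T hTV hTS).resolve_right fun heq => hSV (heq ▸ hTV)
    have hnle : ∀ T ∈ N', ¬ S ≤ T := fun T hT hST => by
      have heq : T₀ = T := by
        by_contra hne
        exact ha hT₀ hT hne (hT₀S.2.trans hST)
      have := Finset.card_le_card (heq ▸ hST : S.1 ⊆ T₀.1)
      rw [hT₀S.1] at this
      omega
    -- The antichain `N'` is compared with `insert S R`, of join `J`. If the join `z` of `N'` were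
    -- in `V`, then `J`, the union of `S` and `z`, which share the vertex `T₀`, would be in `insert
    -- S V` by union closure.
    set R := {T ∈ N' | ¬ T ≤ S} with hR
    have hRN : R ⊆ N := fun T hT => (hN' hT.1).resolve_right fun hv => hT.2 hv.2
    rcases R.eq_empty_or_nonempty with hRe | hRne
    · have hle : S ∈ upperBounds N' := fun T hT => by
        by_contra hcon
        exact Set.eq_empty_iff_forall_notMem.1 hRe T ⟨hT, hcon⟩
      obtain ⟨z, hz, -⟩ := exists_isLUB hle
      refine ⟨z, hz, fun hzV => ?_⟩
      rcases hmin z hzV (hz.2 hle) with hz1 | rfl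
      · obtain ⟨T₁, hT₁, T₂, hT₂, hne⟩ := hn
        refine hne ?_
        rw [eq_of_le_of_card_eq_one (hz.1 hT₁) (hone T₁ hT₁ (hle hT₁)) hz1,
          eq_of_le_of_card_eq_one (hz.1 hT₂) (hone T₂ hT₂ (hle hT₂)) hz1]
      · exact hSV hzV
    · have hanti : IsAntichain (· ≤ ·) (insert S R) := by
        rintro T₁ (rfl | hT₁) T₂ (rfl | hT₂) hne hle
        · exact hne rfl
        · exact hnle T₂ hT₂.1 hle
        · exact hT₁.2 hle
        · exact ha hT₁.1 hT₂.1 hne hle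
      have hnt : (insert S R).Nontrivial := by
        obtain ⟨T, hT⟩ := hRne
        exact ⟨S, Set.mem_insert _ _, T, Set.mem_insert_of_mem _ hT,
          fun heq => hT.2 (heq ▸ le_rfl)⟩
      obtain ⟨J, hJ, hJV⟩ := h.2 _ (Set.insert_subset_insert hRN) hanti hnt
      have hSJ : S ≤ J := hJ.1 (Set.mem_insert _ _)
      have hub : J ∈ upperBounds N' := fun T hT => by
        by_cases hTS : T ≤ S
        · exact hTS.trans hSJ
        · exact hJ.1 (Set.mem_insert_of_mem _ ⟨hT, hTS⟩)
      obtain ⟨z, hz, hzmem⟩ := exists_isLUB hub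
      refine ⟨z, hz, fun hzV => hJV ?_⟩
      refine hcl S (Set.mem_insert _ _) z (Set.mem_insert_of_mem _ hzV) J ?_ fun p => ?_
      · obtain ⟨p, hp⟩ := Finset.card_eq_one.1 hT₀S.1
        have hpT₀ : p ∈ T₀.1 := hp ▸ Finset.mem_singleton_self p
        exact ⟨p, hT₀S.2 hpT₀, hz.1 hT₀ hpT₀⟩
      · constructor
        · intro hp
          obtain ⟨T, hT, hpT⟩ := (hJ.mem_facePoset_iff p).1 hp
          rcases hT with rfl | hT
          · exact Or.inl hpT
          · exact Or.inr (hz.1 hT.1 hpT)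
        · rintro (hp | hp)
          · exact hSJ hp
          · exact hz.2 hub hp
  · rintro ⟨h, hnot⟩
    have hN : IsNested V N := h.mono Set.subset_union_left
    refine ⟨hN.1, Set.insert_subset_insert hN.1, fun N' hN' ha hn => ?_⟩
    by_cases hSN' : S ∈ N'
    swap
    · exact (hiff.2 ⟨hN, hnot⟩).2.2 N'
        (fun T hT => (hN' hT).resolve_left fun heq => hSN' (heq ▸ hT)) ha hn
    set R := N' \ {S} with hR
    have hRN : R ⊆ N := fun T hT => (hN' hT.1).resolve_left hT.2
    have hRS : ∀ T ∈ R, ¬ T ≤ S := fun T hT => ha hT.1 hSN' hT.2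
    have hSR : ∀ T ∈ R, ¬ S ≤ T := fun T hT => ha hSN' hT.1 (Ne.symm hT.2)
    -- Replacing `S` by those of its vertices that lie in no other member of `N'` leaves an
    -- antichain with the same upper bounds.
    set M := {T ∈ S.vertices | ∀ T' ∈ R, ¬ T ≤ T'} with hM
    obtain ⟨T₁, hT₁, hT₁S⟩ := hn.exists_ne S
    have hT₁R : T₁ ∈ R := ⟨hT₁, hT₁S⟩
    have hcover : ∀ p ∈ S.1, (∃ T ∈ R, p ∈ T.1) ∨ ∃ T ∈ M, p ∈ T.1 := by
      intro p hp
      obtain ⟨T, hT⟩ := exists_singleton hp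
      have hpT : p ∈ T.1 := hT ▸ Finset.mem_singleton_self p
      by_cases hcon : ∃ T' ∈ R, T ≤ T'
      · obtain ⟨T', hT', hle⟩ := hcon
        exact Or.inl ⟨T', hT', hle hpT⟩
      · push Not at hcon
        refine Or.inr ⟨T, ⟨⟨by rw [hT, Finset.card_singleton], ?_⟩, hcon⟩, hpT⟩
        exact (hT.trans_le (Finset.singleton_subset_iff.2 hp) : T.1 ≤ S.1)
    have hanti : IsAntichain (· ≤ ·) (R ∪ M) := by
      rintro T hT T' hT' hne hle
      rcases hT with hT | hT <;> rcases hT' with hT' | hT'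
      · exact ha hT.1 hT'.1 hne hle
      · exact hRS T hT (hle.trans hT'.1.2)
      · exact hT.2 T' hT' hle
      · exact S.isAntichain_vertices hT.1 hT'.1 hne hle
    have hnt : (R ∪ M).Nontrivial := by
      obtain ⟨p, hp, hpT₁⟩ := Finset.not_subset.1 (hSR T₁ hT₁R)
      rcases hcover p hp with ⟨T, hT, hpT⟩ | ⟨T, hT, hpT⟩
      · exact ⟨T, Or.inl hT, T₁, Or.inl hT₁R, fun heq => hpT₁ (heq ▸ hpT)⟩
      · exact ⟨T, Or.inr hT, T₁, Or.inl hT₁R, fun heq => hpT₁ (heq ▸ hpT)⟩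
    obtain ⟨J, hJ, hJV⟩ := h.2 (R ∪ M)
      (Set.union_subset_union hRN fun T hT => hT.1) hanti hnt
    refine ⟨J, ⟨fun T hT => ?_, fun w hw => hJ.2 ?_⟩, ?_⟩
    · by_cases hTS : T = S
      · rw [hTS]
        intro p hp
        rcases hcover p hp with ⟨T, hT, hpT⟩ | ⟨T, hT, hpT⟩
        · exact hJ.1 (Or.inl hT) hpT
        · exact hJ.1 (Or.inr hT) hpT
      · exact hJ.1 (Or.inl ⟨hT, hTS⟩)
    · rintro T (hT | hT)
      · exact hw hT.1
      · exact hT.1.2.trans (hw hSN')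
    · rintro (rfl | hV)
      · exact hRS T₁ hT₁R (hJ.1 (Or.inl hT₁R))
      · exact hJV hV

end Adjoin

/-- The nested sets of the building set of all vertices are the sets of vertices of a face. -/
theorem isNested_vertices_iff {N : Set (FacePoset K)} :
    IsNested {T : FacePoset K | T.1.card = 1} N ↔
      N ⊆ {T : FacePoset K | T.1.card = 1} ∧ BddAbove N := by
  refine and_congr_right fun hN => ⟨fun h => ?_, fun ⟨u, hu⟩ N' hN' _ hn => ?_⟩
  · rcases N.subsingleton_or_nontrivial with hs | hn
    · rcases N.eq_empty_or_nonempty with rfl | ⟨T, hT⟩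
      · exact bddAbove_empty
      · exact ⟨T, fun T' hT' => (hs hT' hT).le⟩
    · obtain ⟨z, hz, -⟩ := h N subset_rfl
        (fun T hT T' hT' hne hle => hne (eq_of_le_of_card_eq_one hle (hN hT) (hN hT'))) hn
      exact ⟨z, hz.1⟩
  · obtain ⟨z, hz, -⟩ := exists_isLUB (upperBounds_mono_set hN' hu)
    refine ⟨z, hz, fun hz1 => ?_⟩
    obtain ⟨T, hT, T', hT', hne⟩ := hn
    refine hne ?_
    rw [eq_of_le_of_card_eq_one (hz.1 hT) (hN (hN' hT)) hz1,
      eq_of_le_of_card_eq_one (hz.1 hT') (hN (hN' hT')) hz1]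

/-! ### Building sets of face posets -/

variable {B : Set (FacePoset K)}

theorem ne_bot_of_mem {S : FacePoset K} {p : ι} (hp : p ∈ S.1) : S ≠ ⊥ := by
  rintro rfl
  exact absurd hp (Finset.notMem_empty p)

/-- With nothing of `B` below a vertex, the empty product would be a single point, while the
interval has two. -/
theorem _root_.IsBuildingSet.mem_of_card_eq_one (hB : IsBuildingSet B) {S : FacePoset K}
    (hS : S.1.card = 1) : S ∈ B := by
  obtain ⟨p, hp⟩ := Finset.card_eq_one.1 hS
  have hbot : S ≠ ⊥ := ne_bot_of_mem (p := p) (hp ▸ Finset.mem_singleton_self p)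
  obtain ⟨φ, -⟩ := hB.2 S hbot
  have hne : Nonempty (maxBelow B S) := by
    by_contra hcon
    rw [not_nonempty_iff] at hcon
    have : φ.symm ⟨⊥, Set.mem_Iic.2 bot_le⟩ = φ.symm ⟨S, Set.mem_Iic.2 le_rfl⟩ := Subsingleton.elim _ _
    exact hbot (congrArg Subtype.val (φ.symm.injective this)).symm
  obtain ⟨T, hT⟩ := hne
  obtain ⟨⟨hTB, hTS⟩, -⟩ := hT
  have hT1 : T.1.card = 1 := by
    have h₁ := Finset.card_le_card (hTS : T.1 ⊆ S.1)
    have h₂ : T.1.card ≠ 0 := fun h0 =>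
      hB.1 ((Subtype.ext (Finset.card_eq_zero.1 h0) : T = ⊥) ▸ hTB)
    omega
  exact eq_of_le_of_card_eq_one hTS hT1 hS ▸ hTB

-- Take maximal elements of `B` below `J` above `S` and above `T`. If they differ, the atom of a
-- common vertex corresponds to a tuple supported in two different coordinates, hence to `⊥`. So
-- they agree and equal `J`.
open Classical in
theorem _root_.IsBuildingSet.isUnionClosed [Finite ι] (hB : IsBuildingSet B) :
    IsUnionClosed B := by
  rintro S hS T hT J ⟨p, hpS, hpT⟩ hJ
  have hfin : Finite (FacePoset K) :=
    inferInstanceAs (Finite {S : Finset ι // S = ∅ ∨ S ∈ K.faces})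
  have hSJ : S ≤ J := fun q hq => (hJ q).2 (Or.inl hq)
  have hTJ : T ≤ J := fun q hq => (hJ q).2 (Or.inr hq)
  obtain ⟨S', hSS', hS'⟩ := (Set.toFinite {z | z ∈ B ∧ z ≤ J}).exists_le_maximal
    (⟨hS, hSJ⟩ : S ∈ {z | z ∈ B ∧ z ≤ J})
  obtain ⟨T', hTT', hT'⟩ := (Set.toFinite {z | z ∈ B ∧ z ≤ J}).exists_le_maximal
    (⟨hT, hTJ⟩ : T ∈ {z | z ∈ B ∧ z ≤ J})
  have hpJ : p ∈ J.1 := hSJ hpS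
  by_cases heq : S' = T'
  · have : J = S' := le_antisymm (fun q hq => ((hJ q).1 hq).elim (fun h => hSS' h)
      fun h => heq ▸ hTT' h) hS'.prop.2
    exact this ▸ hS'.prop.1
  · obtain ⟨φ, hφ⟩ := hB.2 J (ne_bot_of_mem hpJ)
    obtain ⟨Z, hZ⟩ := exists_singleton hpJ
    have hZle : ∀ W : FacePoset K, p ∈ W.1 → Z ≤ W := fun W hW =>
      (hZ.trans_le (Finset.singleton_subset_iff.2 hW) : Z.1 ≤ W.1)
    have hle : ∀ j : maxBelow B J, p ∈ j.1.1 → φ.symm ⟨Z, hZle J hpJ⟩ ≤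
        Function.update (fun i : maxBelow B J => (⊥ : Set.Iic (i : FacePoset K))) j ⊤ := fun j hj => by
      rw [OrderIso.symm_apply_le, ← Subtype.coe_le_coe, hφ]
      exact hZle _ hj
    have hbot : φ.symm ⟨Z, hZle J hpJ⟩ ≤ φ.symm ⟨⊥, Set.mem_Iic.2 bot_le⟩ := by
      refine le_trans (fun i => ?_) bot_le
      show _ ≤ (⊥ : Set.Iic (i : FacePoset K))
      by_cases hi : i = ⟨S', hS'⟩
      · have h₁ := hle ⟨T', hT'⟩ (hTT' hpT) i
        rwa [Function.update_of_ne (fun h => heq (congrArg Subtype.val (hi.symm.trans h)))] at h₁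
      · have h₁ := hle ⟨S', hS'⟩ (hSS' hpS) i
        rwa [Function.update_of_ne hi] at h₁
    have hZbot : Z ≤ ⊥ := φ.symm.le_iff_le.1 hbot
    exact absurd (hZbot (hZ ▸ Finset.mem_singleton_self p : p ∈ Z.1)) (Finset.notMem_empty p)

end FacePoset

end Combinatorics

/-! ### Successive truncations along a building set -/

section Nestohedra

open Classical FacePoset

variable {E : Type*} [AddCommGroup E] [Module ℝ E] {P : Set E}

/-- The vertex of the dual complex given by a facet. -/
def facetVertex (s : Facet P) : FacePoset (dualComplex P) :=
  ⟨{s}, Or.inr ((dualComplex P).singleton_mem s)⟩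

theorem facetVertex_injective : Function.Injective (facetVertex (P := P)) :=
  fun _ _ h => Finset.singleton_injective (congrArg Subtype.val h)

theorem exists_facetVertex_eq {T : FacePoset (dualComplex P)} (hT : T.1.card = 1) :
    ∃ s, facetVertex s = T := by
  obtain ⟨s, hs⟩ := Finset.card_eq_one.1 hT
  exact ⟨s, Subtype.ext hs.symm⟩

theorem facetVertex_le_iff {s : Facet P} {T : FacePoset (dualComplex P)} :
    facetVertex s ≤ T ↔ s ∈ T.1 := Finset.singleton_subset_iff

/-- The vertices of the dual complex of `P` together with the faces in a list. -/
def verticesAnd (l : List (FacePoset (dualComplex P))) : Set (FacePoset (dualComplex P)) :=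
  {T | T.1.card = 1 ∨ T ∈ l}

/-- The polyhedron `Q` has arisen from `P` by truncating the faces in the list `l`: it is described
by a regular system indexed by the vertices and the elements of `l`, sets of constraints are
simultaneously active if and only if they are nested, and the facets not in `l` are inherited from
those of `P`. -/
structure IsTruncationStage (l : List (FacePoset (dualComplex P))) (Q : Set E)
    (a : FacePoset (dualComplex P) → Module.Dual ℝ E) (b : FacePoset (dualComplex P) → ℝ) :
    Prop where
  regular : IsRegularSystem (verticesAnd l) a b
  eq_solutionSet : Q = solutionSet (verticesAnd l) a b
  nested : ∀ N ⊆ verticesAnd l, (tightFace (verticesAnd l) a b N).Nonempty ↔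
    IsNested (verticesAnd l) N
  facet : ∀ s : Facet P, facetVertex s ∉ l →
    s.1 ∩ Q = tightFace (verticesAnd l) a b {facetVertex s}

variable [FiniteDimensional ℝ E]

theorem IsSimplePolyhedron.exists_isTruncationStage (hP : IsSimplePolyhedron P) :
    ∃ a b, IsTruncationStage (P := P) [] P a b := by
  obtain ⟨a, b, hsol, hreg, hfacet⟩ := hP.exists_isRegularSystem
  have hV : verticesAnd ([] : List (FacePoset (dualComplex P))) = Set.range facetVertex := by
    ext T
    simp only [verticesAnd, List.not_mem_nil, or_false, Set.mem_ofPred_eq]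
    refine ⟨fun hT => exists_facetVertex_eq hT, ?_⟩
    rintro ⟨s, rfl⟩
    exact Finset.card_singleton s
  have hV' : verticesAnd ([] : List (FacePoset (dualComplex P))) = {T | T.1.card = 1} := by
    simp [verticesAnd]
  -- The default `0` is harmless, since only vertices index this system.
  have ha : ∀ s, Function.extend facetVertex a 0 (facetVertex s) = a s :=
    fun s => facetVertex_injective.extend_apply _ _ _
  have hb : ∀ s, Function.extend facetVertex b 0 (facetVertex s) = b s :=
    fun s => facetVertex_injective.extend_apply _ _ _
  have hsol' : P = solutionSet (verticesAnd ([] : List (FacePoset (dualComplex P))))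
      (Function.extend facetVertex a 0) (Function.extend facetVertex b 0) := by
    refine hsol.trans ?_
    ext x
    simp [solutionSet, hV, ha, hb]
  have hmem : ∀ (s : Facet P) (x : E), x ∈ s.1 ↔ x ∈ P ∧ a s x = b s := fun s x => by
    rw [hfacet s]
    exact Iff.rfl
  have hfin : Finite (Facet P) := Set.finite_univ_iff.1 hreg.finite
  refine ⟨Function.extend facetVertex a 0, Function.extend facetVertex b 0,
    ⟨hV ▸ Set.finite_range _, ?_, fun x hx => ?_⟩, hsol', fun N hN => ?_, fun s _ => ?_⟩
  · rw [← hsol']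
    by_contra hcon
    have htop := hP.2.1
    rw [Set.not_nonempty_iff_eq_empty.1 hcon, AffineSubspace.span_empty] at htop
    exact AffineSubspace.bot_ne_top ℝ E E htop
  · rw [← hsol'] at hx
    have hact : activeSet (verticesAnd []) (Function.extend facetVertex a 0)
        (Function.extend facetVertex b 0) x = facetVertex '' activeSet Set.univ a b x := by
      rw [hV]
      ext T
      constructor
      · rintro ⟨⟨s, rfl⟩, hs⟩
        rw [ha, hb] at hs
        exact ⟨s, ⟨trivial, hs⟩, rfl⟩
      · rintro ⟨s, hs, rfl⟩
        exact ⟨⟨s, rfl⟩, by rw [ha, hb, hs.2]⟩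
    rw [hact]
    refine LinearIndepOn.image_of_comp _ _ ?_
    exact (hreg.indep x (hsol ▸ hx)).congr fun s _ => (ha s).symm
  · rw [tightFace, ← hsol', hV', isNested_vertices_iff]
    rw [hV'] at hN
    constructor
    · rintro ⟨x, hx, hxN⟩
      refine ⟨hN, ?_⟩
      have hu : {s : Facet P | x ∈ s.1}.Finite := Set.toFinite _
      have hface : hu.toFinset = ∅ ∨ hu.toFinset ∈ (dualComplex P).faces := by
        rcases hu.toFinset.eq_empty_or_nonempty with h | h
        · exact Or.inl h
        · exact Or.inr ⟨h, x, hx, fun s hs => hu.mem_toFinset.1 hs⟩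
      refine ⟨⟨hu.toFinset, hface⟩, fun T hT => ?_⟩
      obtain ⟨s, rfl⟩ := exists_facetVertex_eq (hN hT)
      have := hxN _ hT
      rw [ha, hb] at this
      exact facetVertex_le_iff.2 (hu.mem_toFinset.2 ((hmem s x).2 ⟨hx, this⟩))
    · rintro ⟨-, u, hu⟩
      obtain ⟨x, hx, hxu⟩ : ∃ x ∈ P, ∀ s ∈ u.1, x ∈ s.1 := by
        rcases u.2 with h | ⟨-, x, hx, hxu⟩
        · obtain ⟨x, hx⟩ := hreg.nonempty
          exact ⟨x, hsol ▸ hx, fun s hs => by simp [h] at hs⟩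
        · exact ⟨x, hx, hxu⟩
      refine ⟨x, hx, fun T hT => ?_⟩
      obtain ⟨s, rfl⟩ := exists_facetVertex_eq (hN hT)
      rw [ha, hb]
      exact ((hmem s x).1 (hxu s (facetVertex_le_iff.1 (hu hT)))).2
  · rw [tightFace, ← hsol']
    ext x
    simp only [Set.mem_inter_iff, hmem, Set.mem_singleton_iff, forall_eq, ha, hb,
      Set.mem_ofPred_eq]
    tauto

/-! ### One truncation step and induction along a listing -/

section Step

variable {B : Set (FacePoset (dualComplex P))} {S : FacePoset (dualComplex P)}
  {l l' : List (FacePoset (dualComplex P))} {Q : Set E}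
  {a : FacePoset (dualComplex P) → Module.Dual ℝ E} {b : FacePoset (dualComplex P) → ℝ}

omit [FiniteDimensional ℝ E] in
theorem IsDecreasingListing.card_le (hl : IsDecreasingListing B (l ++ S :: l'))
    {T : FacePoset (dualComplex P)} (hT : T ∈ l) : S.1.card ≤ T.1.card :=
  (List.pairwise_append.1 hl.2.2).2.2 T hT S List.mem_cons_self

omit [FiniteDimensional ℝ E] in
theorem IsDecreasingListing.notMem (hl : IsDecreasingListing B (l ++ S :: l')) : S ∉ l :=
  fun h => (List.nodup_append.1 hl.1).2.2 S h S List.mem_cons_self rfl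

omit [FiniteDimensional ℝ E] in
theorem IsDecreasingListing.nonempty (hB : IsBuildingSet B)
    (hl : IsDecreasingListing B (l ++ S :: l')) : S.1.Nonempty := by
  rw [Finset.nonempty_iff_ne_empty]
  intro h
  have hS : S ∈ B := (hl.2.1 S).1 (by simp)
  exact hB.1 ((Subtype.ext h : S = ⊥) ▸ hS)

omit [FiniteDimensional ℝ E] in
theorem verticesAnd_concat : verticesAnd (l ++ [S]) = insert S (verticesAnd l) := by
  ext T
  simp only [verticesAnd, List.mem_append, List.mem_singleton, Set.mem_ofPred_eq,
    Set.mem_insert_iff]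
  tauto

omit [FiniteDimensional ℝ E] in
/-- The vertices and the large elements of a building set form again a building set. -/
theorem IsDecreasingListing.isUnionClosed (hB : IsBuildingSet B) [Finite (Facet P)]
    (hl : IsDecreasingListing B (l ++ l')) : IsUnionClosed (verticesAnd l) := by
  have hcl := hB.isUnionClosed
  have hsub : verticesAnd l ⊆ B := by
    rintro T (hT | hT)
    · exact hB.mem_of_card_eq_one hT
    · exact (hl.2.1 T).1 (List.mem_append_left _ hT)
  intro S hS T hT J hST hJ
  have hJB := hcl S (hsub hS) T (hsub hT) J hST hJ
  have hSJ : S ≤ J := fun q hq => (hJ q).2 (Or.inl hq)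
  have hTJ : T ≤ J := fun q hq => (hJ q).2 (Or.inr hq)
  obtain ⟨p, hpS, hpT⟩ := hST
  rcases hS with hS | hS
  · have hle : S ≤ T := fun q hq => by
      rw [Finset.card_eq_one] at hS
      obtain ⟨r, hr⟩ := hS
      rw [hr, Finset.mem_singleton] at hq hpS
      rwa [hq, ← hpS]
    have : J = T := le_antisymm (fun q hq => ((hJ q).1 hq).elim (fun h => hle h) id) hTJ
    exact this ▸ hT
  · rcases List.mem_append.1 ((hl.2.1 J).2 hJB) with h | h
    · exact Or.inr h
    · have hle := (List.pairwise_append.1 hl.2.2).2.2 S hS J h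
      have : S = J := Subtype.ext (Finset.eq_of_subset_of_card_le hSJ hle)
      exact Or.inr (this ▸ hS)

namespace IsTruncationStage

variable (h : IsTruncationStage l Q a b) (hB : IsBuildingSet B)
  (hl : IsDecreasingListing B (l ++ S :: l'))

include h hB hl

-- No facet through the face of `S` has been replaced yet: vertices come last, so one in `l` below
-- `S` would equal `S`, which is not in `l`.
omit [FiniteDimensional ℝ E] in
theorem faceOf_inter : faceOf P S.1 ∩ Q = tightFace (verticesAnd l) a b S.vertices := by
  have hnot : ∀ s ∈ S.1, facetVertex s ∉ l := fun s hs hmem => by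
    have hle : facetVertex s ≤ S := facetVertex_le_iff.2 hs
    have hcard : S.1.card ≤ (facetVertex s).1.card := hl.card_le hmem
    exact hl.notMem ((Subtype.ext (Finset.eq_of_subset_of_card_le hle hcard) :
      facetVertex s = S) ▸ hmem)
  ext x
  constructor
  · rintro ⟨⟨-, hxS⟩, hxQ⟩
    refine ⟨h.eq_solutionSet ▸ hxQ, fun T hT => ?_⟩
    obtain ⟨s, rfl⟩ := exists_facetVertex_eq hT.1
    have hs : s ∈ S.1 := facetVertex_le_iff.1 hT.2
    exact ((h.facet s (hnot s hs)).subset ⟨hxS s hs, hxQ⟩).2 _ rfl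
  · rintro ⟨hxQ, hxS⟩
    have key : ∀ s ∈ S.1, x ∈ s.1 := fun s hs => by
      refine ((h.facet s (hnot s hs)).symm.subset ⟨hxQ, ?_⟩).1
      rintro _ rfl
      exact hxS _ ⟨Finset.card_singleton s, facetVertex_le_iff.2 hs⟩
    obtain ⟨s, hs⟩ := hl.nonempty hB
    exact ⟨⟨s.2.1.subset (key s hs), key⟩, h.eq_solutionSet ▸ hxQ⟩

omit [FiniteDimensional ℝ E] in
theorem exists_truncates : ∃ α β, Truncates α β Q (faceOf P S.1 ∩ Q) := by
  rw [h.faceOf_inter hB hl, h.eq_solutionSet]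
  exact _root_.exists_truncates h.regular.finite
    (isFace_tightFace h.regular.finite fun T hT => Or.inl hT.1)

/-- The geometric and the combinatorial subdivision rules are matched, separately for index sets
with and without `S`, for an arbitrary truncating inequality. -/
theorem truncate [Finite (Facet P)] {α : Module.Dual ℝ E} {β : ℝ}
    (ht : Truncates α β Q (faceOf P S.1 ∩ Q)) :
    IsTruncationStage (l ++ [S]) (Q ∩ {x | α x ≤ β}) (Function.update a S α)
      (Function.update b S β) := by
  rw [h.faceOf_inter hB hl, h.eq_solutionSet] at ht
  have hσ : S.vertices ⊆ verticesAnd l := fun T hT => Or.inl hT.1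
  have hne : S.vertices.Nonempty := by
    obtain ⟨s, hs⟩ := hl.nonempty hB
    exact ⟨_, Finset.card_singleton s, facetVertex_le_iff.2 hs⟩
  have hS : S.1.card ≠ 1 → 1 < S.1.card ∧ S ∉ verticesAnd l := fun hcard =>
    ⟨lt_of_le_of_ne (hl.nonempty hB).card_pos (Ne.symm hcard),
      fun hmem => hmem.elim hcard hl.notMem⟩
  have hs : S.vertices = {S} ∨ S ∉ verticesAnd l := by
    by_cases hcard : S.1.card = 1
    · exact Or.inl (vertices_eq_singleton hcard)
    · exact Or.inr (hS hcard).2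
  have hmin : ∀ T ∈ verticesAnd l, T ≤ S → T.1.card = 1 ∨ T = S := by
    rintro T (hT | hT) hTS
    · exact Or.inl hT
    · exact Or.inr (Subtype.ext (Finset.eq_of_subset_of_card_le hTS (hl.card_le hT)))
  have hsing : ∀ T : FacePoset (dualComplex P), T.1.card = 1 → T ∈ verticesAnd l :=
    fun T hT => Or.inl hT
  have hcl : IsUnionClosed (insert S (verticesAnd l)) := by
    rw [← verticesAnd_concat]
    refine IsDecreasingListing.isUnionClosed (l' := l') hB ?_
    rwa [List.append_assoc, List.singleton_append]
  refine ⟨?_, ?_, fun N hN => ?_, fun s hsl => ?_⟩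
  · rw [verticesAnd_concat]
    exact h.regular.insert_update hσ ht hne hs
  · rw [verticesAnd_concat, h.regular.solutionSet_insert_update hσ ht hne hs, h.eq_solutionSet]
  · rw [verticesAnd_concat] at hN ⊢
    by_cases hSN : S ∈ N
    · have hM : N \ {S} ⊆ verticesAnd l := fun T hT => (hN hT.1).resolve_left hT.2
      have hSM : S ∉ N \ {S} := fun hmem => hmem.2 rfl
      have hiff := isNested_insert_insert_iff hmin hS hsing hSM hcl
      rw [← Set.insert_sdiff_self_of_mem hSN,
        h.regular.tightFace_insert_update_insert hσ ht hne hs hSM,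
        h.regular.tightFace_inter_hyperplane_nonempty_iff hσ ht hM,
        h.nested _ (Set.union_subset hM hσ), ← hiff, and_iff_right hM]
    · have hM : N ⊆ verticesAnd l := fun T hT =>
        (hN hT).resolve_left fun heq => hSN (heq ▸ hT)
      have hiff := isNested_insert_iff_of_notMem hmin hS hsing hSN
      rw [h.regular.tightFace_insert_update hσ ht hne hs hSN,
        h.regular.tightFace_inter_halfspace_nonempty_iff hσ ht hM, h.nested _ hM, ← hiff,
        and_iff_right hM]
  · rw [List.mem_append, List.mem_singleton, not_or] at hsl
    rw [verticesAnd_concat, h.regular.tightFace_insert_update hσ ht hne hs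
      (fun hmem => hsl.2 (Eq.symm hmem)), ← h.facet s hsl.1, Set.inter_assoc]

end IsTruncationStage

theorem IsTruncationStage.exists_repeatedTruncation_and
    [Finite (Facet P)] (hB : IsBuildingSet B) (h : IsTruncationStage l Q a b)
    (hl : IsDecreasingListing B (l ++ l')) :
    (∃ R, RepeatedTruncation Q (l'.map fun S => faceOf P S.1) R) ∧
      ∀ R, RepeatedTruncation Q (l'.map fun S => faceOf P S.1) R →
        ∃ a b, IsTruncationStage (l ++ l') R a b := by
  induction l' generalizing l Q a b with
  | nil =>
    refine ⟨⟨Q, .nil Q⟩, ?_⟩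
    rintro _ ⟨⟩
    rw [List.append_nil]
    exact ⟨a, b, h⟩
  | cons S l' ih =>
    have hl' : IsDecreasingListing B ((l ++ [S]) ++ l') := by
      rwa [List.append_assoc, List.singleton_append]
    constructor
    · obtain ⟨α, β, ht⟩ := h.exists_truncates hB hl
      obtain ⟨R, hR⟩ := (ih (h.truncate hB hl ht) hl').1
      exact ⟨R, .cons α β ht hR⟩
    · rintro R (_ | ⟨α, β, ht, hR⟩)
      have := (ih (h.truncate hB hl ht) hl').2 R hR
      rwa [List.append_assoc, List.singleton_append] at this

theorem IsTruncationStage.isNestohedron (hB : IsBuildingSet B) (h : IsTruncationStage l Q a b)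
    (hl : IsDecreasingListing B l) : IsNestohedron B Q := by
  obtain ⟨hreg, rfl, hnested, -⟩ := h
  have hV : verticesAnd l = B := by
    ext T
    refine ⟨?_, fun hT => Or.inr ((hl.2.1 T).2 hT)⟩
    rintro (hT | hT)
    · exact hB.mem_of_card_eq_one hT
    · exact (hl.2.1 T).1 hT
  rw [hV] at hreg hnested ⊢
  have hK : ∀ S : Finset B, S ∈ (nestedComplex B).faces ↔
      S.Nonempty ∧ (tightFace B a b (Subtype.val '' (S : Set B))).Nonempty := fun S => by
    rw [hnested _ (Subtype.coe_image_subset B _)]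
    exact Iff.rfl
  -- Singletons are nested, so no constraint is vacuous and each defines a facet.
  have htight : ∀ S ∈ B, (tightFace B a b {S}).Nonempty := fun S hS => by
    simpa using ((hK {⟨S, hS⟩}).1 ((nestedComplex B).singleton_mem _)).2
  exact ⟨hreg.isSimplePolyhedron htight, hreg.simplicialIsomorphic htight _ hK⟩

end Step

omit [FiniteDimensional ℝ E] in
theorem exists_isDecreasingListing [Finite (Facet P)] (B : Set (FacePoset (dualComplex P))) :
    ∃ l, IsDecreasingListing B l := by
  have hfin : Finite (FacePoset (dualComplex P)) :=
    inferInstanceAs (Finite {S : Finset (Facet P) // S = ∅ ∨ S ∈ (dualComplex P).faces})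
  let r : FacePoset (dualComplex P) → FacePoset (dualComplex P) → Prop :=
    fun S T => T.1.card ≤ S.1.card
  have : Std.Total r := ⟨fun S T => le_total _ _⟩
  have : IsTrans _ r := ⟨fun S T U h₁ h₂ => le_trans h₂ h₁⟩
  have hperm := List.perm_insertionSort r (Set.toFinite B).toFinset.toList
  refine ⟨List.insertionSort r (Set.toFinite B).toFinset.toList, ?_, fun S => ?_, ?_⟩
  · exact hperm.nodup_iff.2 (Finset.nodup_toList _)
  · rw [hperm.mem_iff]
    simp
  · exact List.pairwise_insertionSort r _

end Nestohedra

theorem mainTheorem9 {E : Type*} [AddCommGroup E] [Module ℝ E] [FiniteDimensional ℝ E]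
    (P : Set E) (hP : IsSimplePolyhedron P)
    (B : Set (FacePoset (dualComplex P))) (hB : IsBuildingSet B) :
    (∃ l, IsDecreasingListing B l) ∧
      ∀ l, IsDecreasingListing B l →
        (∃ Q, RepeatedTruncation P (l.map fun S => faceOf P S.1) Q) ∧
          ∀ Q, RepeatedTruncation P (l.map fun S => faceOf P S.1) Q → IsNestohedron B Q := by
  have hfin : Finite (Facet P) := by
    obtain ⟨a, b, -, h, -⟩ := hP.exists_isRegularSystem
    exact Set.finite_univ_iff.1 h.finite
  obtain ⟨a, b, h⟩ := hP.exists_isTruncationStage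
  refine ⟨exists_isDecreasingListing B, fun l hl => ?_⟩
  obtain ⟨hex, hall⟩ := h.exists_repeatedTruncation_and hB (l' := l) hl
  refine ⟨hex, fun Q hQ => ?_⟩
  obtain ⟨a', b', h'⟩ := hall Q hQ
  exact h'.isNestohedron hB hl
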